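/- Let $d,m\ge 1$, let $X$ be an $\mathbb{R}^d$-valued random variable on a probability space $(\Omega,\mathcal F,\mathbb P)$, let $f:\mathbb{R}^d\times\mathbb{R}^m\to\mathbb{R}$ satisfy $f(X,\theta)\in L^1(\mathbb P)$ for all $\theta$, and put $F(\theta)=\mathbb{E}[f(X,\theta)]$. Let $g:\mathbb{R}^d\times\mathbb{R}^m\to\mathbb{R}^m$ be measurable, put $b(\theta)=\mathbb{E}[g(X,\theta)]$, let $(X_n)_{n\ge1}$ be i.i.d. copies of $X$, let $\theta_0\in L^2(\mathbb P)$ be an $\mathbb{R}^m$-valued random variable independent of $(X_n)_{n\ge1}$, and let $$\theta_n=\theta_{n-1}-\gamma_n\,g(X_n,\theta_{n-1}),\qquad n\ge1.$$ Assume: 1. $\inf F>-\infty$, $F$ is differentiable, and $\|\nabla F(\theta')-\nabla F(\theta)\|\le L\|\theta'-\theta\|^\alpha$ for all $\theta,\theta'\in\mathbb{R}^m$, with $L>0$, $\alpha\in(0,1]$. 2. There are $C>0$ and $0<\kappa\le c$ such that for all $\theta$: $\mathbb{E}\|g(X,\theta)\|^2\le C(F(\theta)-\inf F+1)$ (in particular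 this expectation is finite), $b(\theta)^\top\nabla F(\theta)\ge\kappa\|\nabla F(\theta)\|^2$, and $\|b(\theta)\|\le c\|\nabla F(\theta)\|$. 3. $\gamma_n>0$ for $n\ge1$, $\sum_{n\ge1}\gamma_n=\infty$ and $\sum_{n\ge1}\gamma_n^{1+\alpha}<\infty$. 4. $F(\theta)\to\infty$ as $\|\theta\|\to\infty$. 5. $F$ is continuously differentiable, and for every $\theta_\circ$ with $\nabla F(\theta_\circ)=0$ there are an open neighborhood $V$ of $\theta_\circ$, $\beta\in(0,1)$ and $\zeta>0$ such that $|F(\theta)-F(\theta_\circ)|^\beta\le\zeta\|\nabla F(\theta)\|$ for all $\theta\in V$. 6. Either (a) $\ln(\gamma_{n-1}/\gamma_n)=o(\gamma_n)$, or (b) $\ln(\gamma_{n-1}/\gamma_n)\sim\gamma_n/\gamma_\star$ for some $\gamma_\star>0$; moreover $\sum_{n\ge1}\gamma_n/\sum_{k=1}^n\gamma_k=\infty$, and $\gamma_n=O\big((\sum_{k=1}^n\gamma_k)^{-\rho}\big)$ for some $\rho>1/\alpha$. 7. $\gamma_n=\Theta(n^{-s})$ with $s\in(0,1]$. Suppose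 in addition that $\rho>\max(3,2/\alpha)$, that $s\in\big[\tfrac{\rho}{1+\rho},1\big]$, and that $\kappa\gamma_\star>\max(\tfrac12,\alpha)$ if $s=1$ (in which case alternative 6(b) necessarily holds). Then $F(\theta_n)$ converges almost surely to a real random variable $F_\star\in L^1(\mathbb P)$, and $(\theta_n)_{n\ge0}$ converges almost surely to an $\mathbb{R}^m$-valued random variable $\theta_\star$ such that, almost surely, $\nabla F(\theta_\star)=0$ and $F(\theta_\star)=F_\star$. -/

import Mathlib

open MeasureTheory ProbabilityTheory Filter Topology Asymptotics

/-- `ℝᵏ` with its Euclidean norm. -/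
abbrev Vec (k : ℕ) : Type := EuclideanSpace ℝ (Fin k)

noncomputable section

namespace SGD

/-- The objective `F(θ) = 𝔼[f(X, θ)]`. -/
def objective {Ω : Type*} [MeasurableSpace Ω] (P : Measure Ω) {d m : ℕ}
    (f : Vec d → Vec m → ℝ) (X : Ω → Vec d) (θ : Vec m) : ℝ :=
  ∫ ω, f (X ω) θ ∂P

/-- The mean field `b(θ) = 𝔼[g(X, θ)]` of the gradient oracle `g`. -/
def meanField {Ω : Type*} [MeasurableSpace Ω] (P : Measure Ω) {d m : ℕ}
    (g : Vec d → Vec m → Vec m) (X : Ω → Vec d) (θ : Vec m) : Vec m :=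
  ∫ ω, g (X ω) θ ∂P

/-- The iterates `θₙ = θₙ₋₁ - γₙ g(Xₙ, θₙ₋₁)`, `n ≥ 1`, started at `θ₀`.  The values `γ 0` and
`ξ 0` are never used. -/
def iterate {Ω : Type*} {d m : ℕ} (g : Vec d → Vec m → Vec m) (γ : ℕ → ℝ)
    (ξ : ℕ → Ω → Vec d) (θ₀ : Ω → Vec m) : ℕ → Ω → Vec m
  | 0 => θ₀
  | n + 1 => fun ω =>
      iterate g γ ξ θ₀ n ω - γ (n + 1) • g (ξ (n + 1) ω) (iterate g γ ξ θ₀ n ω)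

/-- The innovations `(Xₙ)`, `n ≥ 1`, are i.i.d. copies of `X`, and the square integrable initial
point `θ₀` is independent of the whole sequence `(Xₙ)`, `n ≥ 1`. -/
structure Randomness {Ω : Type*} [MeasurableSpace Ω] (P : Measure Ω) {d m : ℕ}
    (X : Ω → Vec d) (ξ : ℕ → Ω → Vec d) (θ₀ : Ω → Vec m) : Prop where
  measurable_X : Measurable X
  measurable_innovation : ∀ n, 1 ≤ n → Measurable (ξ n)
  identDistrib : ∀ n, 1 ≤ n → IdentDistrib (ξ n) X P P
  iIndep : iIndepFun (fun n : ℕ => ξ (n + 1)) P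
  measurable_init : Measurable θ₀
  memLp_init : MemLp θ₀ 2 P
  indep_init : IndepFun θ₀ (fun ω (n : ℕ) => ξ (n + 1) ω) P

/-- `F` is bounded below and differentiable, and `∇F` is `(L, α)`-Hölder, `L > 0`, `α ∈ (0, 1]`. -/
structure HolderSmooth {m : ℕ} (F : Vec m → ℝ) (L α : ℝ) : Prop where
  L_pos : 0 < L
  α_pos : 0 < α
  α_le_one : α ≤ 1
  bddBelow : BddBelow (Set.range F)
  differentiable : Differentiable ℝ F
  holder : ∀ θ θ' : Vec m, ‖gradient F θ' - gradient F θ‖ ≤ L * ‖θ' - θ‖ ^ α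

/-- The conditions on the oracle `g`: expected growth of the second moment with constant `C`,
alignment of the mean field with `∇F` with constant `κ`, and domination of the mean field by
`∇F` with constant `c`. -/
structure OracleConditions {Ω : Type*} [MeasurableSpace Ω] (P : Measure Ω) {d m : ℕ}
    (F : Vec m → ℝ) (g : Vec d → Vec m → Vec m) (X : Ω → Vec d) (C κ c : ℝ) : Prop where
  C_pos : 0 < C
  κ_pos : 0 < κ
  κ_le_c : κ ≤ c
  memLp : ∀ θ, MemLp (fun ω => g (X ω) θ) 2 P
  second_moment : ∀ θ, ∫ ω, ‖g (X ω) θ‖ ^ 2 ∂P ≤ C * ((F θ - ⨅ ϑ, F ϑ) + 1)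
  alignment : ∀ θ, κ * ‖gradient F θ‖ ^ 2 ≤ inner ℝ (meanField P g X θ) (gradient F θ)
  domination : ∀ θ, ‖meanField P g X θ‖ ≤ c * ‖gradient F θ‖

/-- The learning rates `(γₙ)`, `n ≥ 1`, are positive with `∑ γₙ = ∞` and `∑ γₙ ^ (1 + α) < ∞`. -/
structure StepSizes (γ : ℕ → ℝ) (α : ℝ) : Prop where
  pos : ∀ n, 1 ≤ n → 0 < γ n
  sum_eq_top : Tendsto (fun n : ℕ => ∑ k ∈ Finset.Icc 1 n, γ k) atTop atTop
  summable_rpow : Summable (fun n : ℕ => γ (n + 1) ^ (1 + α))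

/-- `F(θ) → ∞` as `‖θ‖ → ∞`. -/
def Coercive {m : ℕ} (F : Vec m → ℝ) : Prop :=
  Tendsto F (Bornology.cobounded (Vec m)) atTop

/-- `F` is continuously differentiable and satisfies a Łojasiewicz inequality, with exponent in
`(0, 1)`, around each of its stationary points; exponent, constant and neighbourhood may depend on
the point. -/
structure IsLojasiewicz {m : ℕ} (F : Vec m → ℝ) : Prop where
  contDiff : ContDiff ℝ 1 F
  inequality : ∀ θs : Vec m, gradient F θs = 0 →
    ∃ V : Set (Vec m), IsOpen V ∧ θs ∈ V ∧ ∃ β ζ : ℝ, 0 < β ∧ β < 1 ∧ 0 < ζ ∧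
      ∀ θ ∈ V, |F θ - F θs| ^ β ≤ ζ * ‖gradient F θ‖

/-- `ln (γₙ₋₁ / γₙ) = o(γₙ)`. -/
def SlowDecay (γ : ℕ → ℝ) : Prop :=
  (fun n : ℕ => Real.log (γ (n - 1) / γ n)) =o[atTop] γ

/-- `γ⋆ > 0` and `ln (γₙ₋₁ / γₙ) ∼ γₙ / γ⋆`. -/
def CriticalDecay (γ : ℕ → ℝ) (γs : ℝ) : Prop :=
  0 < γs ∧ (fun n : ℕ => Real.log (γ (n - 1) / γ n)) ~[atTop] (fun n : ℕ => γ n / γs)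

/-- The finer description of the learning rates.  The parameter `γ⋆` matters only in the second
alternative of `decay`. -/
structure StepAsymptotics (γ : ℕ → ℝ) (α γs ρ : ℝ) : Prop where
  decay : SlowDecay γ ∨ CriticalDecay γ γs
  sum_ratio_eq_top : Tendsto
    (fun n : ℕ => ∑ j ∈ Finset.Icc 1 n, γ j / ∑ k ∈ Finset.Icc 1 j, γ k) atTop atTop
  ρ_gt : 1 / α < ρ
  isBigO : γ =O[atTop] (fun n : ℕ => (∑ k ∈ Finset.Icc 1 n, γ k) ^ (-ρ))

/-- `γₙ = Θ(n ^ (-s))` with `s ∈ (0, 1]`. -/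
structure PolynomialSteps (γ : ℕ → ℝ) (s : ℝ) : Prop where
  s_pos : 0 < s
  s_le_one : s ≤ 1
  isTheta : γ =Θ[atTop] (fun n : ℕ => (n : ℝ) ^ (-s))

end SGD

end

namespace SGD

/-! ### Series and real powers -/

/-! Write `η k = γ (k + 1)`, let `t k` be the sum of `η j` over `j ≤ k`, and let `D k` be the oracle
at step `k` minus its mean field. The Hölder descent inequality and the alignment condition give
`F(θ (k+1)) ≤ F(θ k) - κ η k ‖∇F(θ k)‖² + a k`. Here `a k` is the martingale increment `-η k ⟪∇F(θ
k), D k⟫` plus `L (η k)^(1+α)` times one plus the squared norm of the oracle.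

Stability: since `F - inf F + 1 ≥ 1`, the error of order `(η k)^(1+α)` can be absorbed into a factor
`1 + p k` with `p` summable. So this excess is an almost supermartingale, bounded in mean and along
almost every path (`condExp_excess_le`, `bdd_of_almost_supermartingale`). Coercivity then confines
almost every path to a bounded set.

Rate of the noise: as `η = O(t^(-ρ))` with `ρ > 3` and `ρ α > 2`, the Abel–Dini test makes `∑ t^(2q)
η²` and `∑ t^q η^(1+α)` finite for some `q > 1`. Martingale convergence, localized to sublevel sets,
and a first moment bound show that `∑ t^q a` converges almost surely. Abel summation turns this into
a tail of order `t^(-q)` for `∑ a`. The series `∑ η D` converges as well.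

The rest is pathwise (`exists_tendsto_of_perturbed_descent`). Adding the tail of `∑ a` to `F(θ n)`
gives a nonincreasing quantity, and divergence of `∑ η` produces a critical accumulation point. Near
it, the Łojasiewicz inequality bounds the length of the drift part of the path by a potential
tending to zero. The perturbation costs `∑ η t^(-qβ)`, which is finite once `β` has been raised
above `1/q`. The path is therefore trapped and converges. Integrability of the limit value follows
by Fatou from the bound in mean. -/

lemma sub_mul_rpow_neg_le {a b p : ℝ} (ha : 0 < a) (hb : 0 < b) (hp : 1 ≤ p) :
    (p - 1) * ((b - a) * b ^ (-p)) ≤ a ^ (1 - p) - b ^ (1 - p) := by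
  -- Tangent line at 1 of the convex function `r ↦ r ^ (1 - p)`, through `exp x ≥ 1 + x` and `log r
  -- ≤ r - 1`; the sign `1 - p ≤ 0` reverses the second bound.
  have h1 : 1 + (1 - p) * (a / b - 1) ≤ (a / b) ^ (1 - p) := by
    rw [Real.rpow_def_of_pos (div_pos ha hb)]
    have h2 := Real.add_one_le_exp (Real.log (a / b) * (1 - p))
    have h3 := Real.log_le_sub_one_of_pos (div_pos ha hb)
    nlinarith
  rw [Real.div_rpow ha.le hb.le, le_div_iff₀ (Real.rpow_pos_of_pos hb _)] at h1
  have h4 : b ^ (1 - p) = b * b ^ (-p) := by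
    rw [sub_eq_add_neg, Real.rpow_add hb, Real.rpow_one]
  have h5 : (1 + (1 - p) * (a / b - 1)) * b ^ (1 - p)
      = b ^ (1 - p) + (p - 1) * ((b - a) * b ^ (-p)) := by
    rw [h4]; field_simp; ring
  linarith

lemma sum_range_succ_pos {η : ℕ → ℝ} (hη : ∀ k, 0 < η k) (n : ℕ) :
    0 < ∑ j ∈ Finset.range (n + 1), η j :=
  Finset.sum_pos (fun k _ => hη k) ⟨0, by simp⟩

/-- The Abel–Dini test. -/
lemma summable_mul_sum_rpow_neg {η : ℕ → ℝ} (hη : ∀ k, 0 < η k) {p : ℝ} (hp : 1 < p) :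
    Summable (fun k => η k * (∑ j ∈ Finset.range (k + 1), η j) ^ (-p)) := by
  set t : ℕ → ℝ := fun k => ∑ j ∈ Finset.range (k + 1), η j with ht
  have tpos : ∀ k, 0 < t k := sum_range_succ_pos hη
  -- Without the term `k = 0`, each weight `η (k + 1)` is the increment `t (k + 1) - t k`, so the
  -- sum is compared with the integral of `x ^ (-p)` from `t 0` to infinity, whose value is the
  -- constant `c` below.
  rw [← summable_nat_add_iff 1]
  have hnn : ∀ k, 0 ≤ η (k + 1) * t (k + 1) ^ (-p) := fun k =>
    mul_nonneg (hη _).le (Real.rpow_nonneg (tpos _).le _)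
  refine summable_of_sum_range_le (c := (p - 1)⁻¹ * t 0 ^ (1 - p)) hnn fun n => ?_
  have key : ∀ n, (p - 1) * ∑ k ∈ Finset.range n, η (k + 1) * t (k + 1) ^ (-p)
      ≤ t 0 ^ (1 - p) - t n ^ (1 - p) := by
    intro n
    induction n with
    | zero => simp
    | succ n ih =>
      rw [Finset.sum_range_succ, mul_add]
      have h := sub_mul_rpow_neg_le (tpos n) (tpos (n + 1)) hp.le
      have h2 : t (n + 1) - t n = η (n + 1) := by
        simp only [ht]; rw [Finset.sum_range_succ _ (n + 1)]; ring
      rw [h2] at h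
      linarith
  rw [inv_mul_eq_div, le_div_iff₀ (by linarith)]
  have := key n
  have h0 : 0 ≤ t n ^ (1 - p) := Real.rpow_nonneg (tpos _).le _
  linarith

/-- Abel summation: if the weighted series has bounded partial sums, then the series converges at
the inverse rate of the weights. -/
lemma exists_tendsto_sum_of_weighted_bdd {a u : ℕ → ℝ} {B : ℝ} (hu : ∀ n, 0 < u n)
    (hmono : Monotone u) (htop : Tendsto u atTop atTop)
    (hB : ∀ n, |∑ k ∈ Finset.range n, u k * a k| ≤ B) :
    ∃ l, Tendsto (fun n => ∑ k ∈ Finset.range n, a k) atTop (𝓝 l) ∧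
      ∀ n, |∑ k ∈ Finset.range n, a k - l| ≤ 2 * B * (u n)⁻¹ := by
  set N : ℕ → ℝ := fun n => ∑ k ∈ Finset.range n, a k with hN
  set S : ℕ → ℝ := fun n => ∑ k ∈ Finset.range n, u k * a k with hS
  -- Summation by parts: the increments of `T` involve only the bounded sums `S` and the telescoping
  -- differences of `(u n)⁻¹`. Both `T n - l` and `N n - T n` are at most `B * (u n)⁻¹`, whence the
  -- factor 2.
  set T : ℕ → ℝ := fun n => N n - S n * (u n)⁻¹ with hT
  have hstep : ∀ n, T (n + 1) - T n = S (n + 1) * ((u n)⁻¹ - (u (n + 1))⁻¹) := by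
    intro n
    have h1 : N (n + 1) = N n + a n := Finset.sum_range_succ _ _
    have h2 : S (n + 1) = S n + u n * a n := Finset.sum_range_succ _ _
    have h3 := (hu n).ne'
    simp only [hT]
    rw [h1, h2]
    field_simp
    ring
  have hinv : ∀ n, (u (n + 1))⁻¹ ≤ (u n)⁻¹ := fun n =>
    inv_anti₀ (hu n) (hmono n.le_succ)
  have hB0 : 0 ≤ B := (abs_nonneg _).trans (hB 0)
  have hdist : ∀ m n, m ≤ n → |T n - T m| ≤ B * ((u m)⁻¹ - (u n)⁻¹) := by
    intro m n hmn
    induction n, hmn using Nat.le_induction with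
    | base => simp
    | succ n _ ih =>
      have h1 : |T (n + 1) - T n| ≤ B * ((u n)⁻¹ - (u (n + 1))⁻¹) := by
        rw [hstep, abs_mul, abs_of_nonneg (sub_nonneg.2 (hinv n))]
        exact mul_le_mul_of_nonneg_right (hB _) (sub_nonneg.2 (hinv n))
      have := abs_sub_le (T (n + 1)) (T n) (T m)
      linarith
  have hdist' : ∀ m n, m ≤ n → |T n - T m| ≤ B * (u m)⁻¹ := fun m n h =>
    (hdist m n h).trans (mul_le_mul_of_nonneg_left
      (sub_le_self _ (inv_nonneg.2 (hu n).le)) hB0)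
  have hu0 : Tendsto (fun n => (u n)⁻¹) atTop (𝓝 0) := tendsto_inv_atTop_zero.comp htop
  have hcauchy : CauchySeq T := by
    refine cauchySeq_of_le_tendsto_0' (fun n => B * (u n)⁻¹) (fun m n h => ?_) ?_
    · rw [dist_comm, Real.dist_eq]; exact hdist' m n h
    · simpa using hu0.const_mul B
  obtain ⟨l, hl⟩ := cauchySeq_tendsto_of_complete hcauchy
  have hTl : ∀ m, |T m - l| ≤ B * (u m)⁻¹ := by
    intro m
    rw [abs_sub_comm]
    refine le_of_tendsto ((hl.sub_const (T m)).abs) ?_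
    filter_upwards [eventually_ge_atTop m] with n hn using hdist' m n hn
  have hNl : ∀ n, |N n - l| ≤ 2 * B * (u n)⁻¹ := by
    intro n
    have h1 : N n - l = (T n - l) + S n * (u n)⁻¹ := by simp only [hT]; ring
    have h2 : |S n * (u n)⁻¹| ≤ B * (u n)⁻¹ := by
      rw [abs_mul, abs_of_pos (inv_pos.2 (hu n))]
      exact mul_le_mul_of_nonneg_right (hB n) (inv_nonneg.2 (hu n).le)
    rw [h1]
    have := abs_add_le (T n - l) (S n * (u n)⁻¹)
    have := hTl n
    linarith
  refine ⟨l, ?_, hNl⟩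
  rw [tendsto_iff_dist_tendsto_zero]
  refine squeeze_zero (g := fun n => 2 * B * (u n)⁻¹) (fun _ => dist_nonneg) hNl ?_
  simpa using hu0.const_mul (2 * B)

/-! ### Łojasiewicz inequality and perturbed descent -/

/-- Concavity of `x ↦ x ^ (1 - β)`, in the form of Bernoulli's inequality at `b / a`. It converts a
decrease of the function value into a decrease of its power `1 - β`, which is what bounds path
length. -/
lemma one_sub_mul_sub_le {a b β : ℝ} (hb : 0 ≤ b) (hab : b ≤ a) (hβ0 : 0 < β) (hβ1 : β < 1) :
    (1 - β) * (a - b) ≤ a ^ β * (a ^ (1 - β) - b ^ (1 - β)) := by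
  rcases (hb.trans hab).eq_or_lt with h | ha
  · obtain rfl : a = 0 := h.symm
    obtain rfl : b = 0 := le_antisymm hab hb
    simp
  have h1 := rpow_one_add_le_one_add_mul_self (s := b / a - 1) (p := 1 - β)
    (by linarith [div_nonneg hb ha.le]) (by linarith) (by linarith)
  rw [add_sub_cancel, Real.div_rpow hb ha.le, div_le_iff₀ (Real.rpow_pos_of_pos ha _)] at h1
  have h2 : a ^ β * a ^ (1 - β) = a := by rw [← Real.rpow_add ha]; simp
  have h3 := mul_le_mul_of_nonneg_left h1 (Real.rpow_nonneg ha.le β)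
  have h4 : a ^ β * ((1 + (1 - β) * (b / a - 1)) * a ^ (1 - β)) = a + (1 - β) * (b - a) := by
    rw [mul_left_comm, h2]; field_simp
  rw [mul_sub (a ^ β), h2]
  linarith

/-- One step of the Łojasiewicz length estimate with error term `ε`. -/
lemma mul_le_of_lojasiewicz {x x' β κ η G ζ ε : ℝ} (hβ0 : 0 < β) (hβ1 : β < 1) (hκ : 0 < κ)
    (hη : 0 < η) (hζ : 0 < ζ) (hG : 0 ≤ G) (hε : 0 ≤ ε) (hx' : 0 ≤ x')
    (hdec : κ * η * G ^ 2 ≤ x - x') (hloj : x ^ β ≤ ζ * G + ε) :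
    η * G ≤ ζ / ((1 - β) * κ) * (x ^ (1 - β) - x' ^ (1 - β)) + η * ε / ζ := by
  have hxx : x' ≤ x := by
    have : 0 ≤ κ * η * G ^ 2 := by positivity
    linarith
  have hβ : 0 < 1 - β := by linarith
  set Δ := x ^ (1 - β) - x' ^ (1 - β) with hΔ
  have hΔ0 : 0 ≤ Δ := sub_nonneg.2 (Real.rpow_le_rpow hx' hxx hβ.le)
  have h1 := one_sub_mul_sub_le hx' hxx hβ0 hβ1
  have h2 : (1 - β) * (κ * η * G ^ 2) ≤ (ζ * G + ε) * Δ :=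
    (mul_le_mul_of_nonneg_left hdec hβ.le).trans
      (h1.trans (mul_le_mul_of_nonneg_right hloj hΔ0))
  have hs : 0 ≤ ζ * G + ε := by positivity
  -- After multiplication by `ζ G + ε` this follows from `h2`, because `(ζ G - ε)(ζ G + ε) ≤ ζ² G²`.
  -- If that factor vanishes, so do `ζ G` and `ε`.
  have h3 : (1 - β) * κ * (η * G * ζ - η * ε) ≤ ζ ^ 2 * Δ := by
    rcases hs.eq_or_lt with h | h
    · have hG0 : ζ * G = 0 := by nlinarith [mul_nonneg hζ.le hG]
      have hε0 : ε = 0 := by nlinarith [mul_nonneg hζ.le hG]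
      have : η * G * ζ - η * ε = 0 := by rw [hε0]; linear_combination η * hG0
      rw [this, mul_zero]; positivity
    · refine le_of_mul_le_mul_left ?_ h
      have h5 : 0 ≤ (1 - β) * κ * η * ε ^ 2 := by positivity
      have h6 := mul_le_mul_of_nonneg_left h2 (sq_nonneg ζ)
      nlinarith
  have h7 : η * G - η * ε / ζ = (η * G * ζ - η * ε) / ζ := by field_simp
  have h8 : (η * G * ζ - η * ε) / ζ ≤ ζ / ((1 - β) * κ) * Δ := by
    rw [div_le_iff₀ hζ, ← mul_le_mul_iff_right₀ (mul_pos hβ hκ)]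
    refine h3.trans (le_of_eq ?_)
    field_simp
  linarith

lemma gradient_continuous {m : ℕ} {F : Vec m → ℝ} (h : ContDiff ℝ 1 F) :
    Continuous (gradient F) :=
  (InnerProductSpace.toDual ℝ (Vec m)).symm.continuous.comp (h.continuous_fderiv one_ne_zero)

/-- Łojasiewicz inequality with an exponent as close to one as wanted. -/
lemma IsLojasiewicz.exists_ball {m : ℕ} {F : Vec m → ℝ} (hF : IsLojasiewicz F) {θs : Vec m}
    (hθs : gradient F θs = 0) {β₁ : ℝ} (hβ₁ : β₁ < 1) :
    ∃ δ β ζ : ℝ, 0 < δ ∧ 0 < β ∧ β < 1 ∧ β₁ ≤ β ∧ 0 < ζ ∧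
      ∀ θ ∈ Metric.ball θs δ, |F θ - F θs| ^ β ≤ ζ * ‖gradient F θ‖ := by
  obtain ⟨V, hVo, hV, β₀, ζ, hβ₀, hβ₀1, hζ, hineq⟩ := hF.inequality θs hθs
  have h1 : ∀ᶠ θ in 𝓝 θs, |F θ - F θs| < 1 := by
    have : Tendsto (fun θ => |F θ - F θs|) (𝓝 θs) (𝓝 0) := by
      have h := ((hF.contDiff.continuous.tendsto θs).sub_const (F θs)).abs
      simpa using h
    exact this.eventually (gt_mem_nhds one_pos)
  obtain ⟨δ, hδ, hball⟩ := Metric.eventually_nhds_iff_ball.1 (h1.and (hVo.mem_nhds hV))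
  refine ⟨δ, max β₀ β₁, ζ, hδ, lt_max_of_lt_left hβ₀, max_lt hβ₀1 hβ₁, le_max_right _ _, hζ,
    fun θ hθ => le_trans ?_ (hineq θ (hball θ hθ).2)⟩
  exact Real.rpow_le_rpow_of_exponent_ge' (abs_nonneg _) (hball θ hθ).1.le hβ₀.le (le_max_left _ _)

/-- Deterministic core: perturbed gradient descent converges under a Łojasiewicz inequality, when
the error in the descent inequality has tails of order `t ^ (-q)`, `q > 1`, in the time scale `t`
of the step sizes. -/
theorem exists_tendsto_of_perturbed_descent {m : ℕ} {F : Vec m → ℝ} (hF : IsLojasiewicz F)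
    (hbdd : BddBelow (Set.range F)) {θ b D : ℕ → Vec m} {η a : ℕ → ℝ} {κ c q R l : ℝ}
    (hκ : 0 < κ) (hc : 0 < c) (hq : 1 < q) (hη : ∀ k, 0 < η k)
    (hηtop : Tendsto (fun n => ∑ k ∈ Finset.range n, η k) atTop atTop)
    (hrec : ∀ k, θ (k + 1) = θ k - η k • (b k + D k))
    (hb : ∀ k, ‖b k‖ ≤ c * ‖gradient F (θ k)‖)
    (hD : ∃ x, Tendsto (fun n => ∑ k ∈ Finset.range n, η k • D k) atTop (𝓝 x))
    (hdesc : ∀ k, F (θ (k + 1)) ≤ F (θ k) - κ * η k * ‖gradient F (θ k)‖ ^ 2 + a k)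
    (hN : ∀ n, |∑ k ∈ Finset.range n, a k - l|
      ≤ R * (∑ k ∈ Finset.range (n + 1), η k) ^ (-q))
    (hθ : Bornology.IsBounded (Set.range θ)) :
    ∃ θs, Tendsto θ atTop (𝓝 θs) ∧ gradient F θs = 0 := by
  set t : ℕ → ℝ := fun n => ∑ k ∈ Finset.range (n + 1), η k with ht
  have tpos : ∀ n, 0 < t n := sum_range_succ_pos hη
  have ttop : Tendsto t atTop atTop := hηtop.comp (tendsto_add_atTop_nat 1)
  set N : ℕ → ℝ := fun n => ∑ k ∈ Finset.range n, a k with hNdef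
  set G : ℕ → ℝ := fun n => ‖gradient F (θ n)‖ with hG
  have hR : 0 ≤ R := nonneg_of_mul_nonneg_left ((abs_nonneg _).trans (hN 0))
    (Real.rpow_pos_of_pos (tpos 0) _)
  have hgc := gradient_continuous hF.contDiff
  have hNl : Tendsto N atTop (𝓝 l) := by
    rw [tendsto_iff_dist_tendsto_zero]
    refine squeeze_zero (g := fun n => R * t n ^ (-q)) (fun _ => dist_nonneg) hN ?_
    simpa using ((tendsto_rpow_neg_atTop (by linarith : 0 < q)).comp ttop).const_mul R
  -- `l - N n` is the sum of the errors still to come. Adding it to `F (θ n)` makes the descent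
  -- exactly monotone without changing the limit.
  set Y : ℕ → ℝ := fun n => F (θ n) - N n + l with hY
  have hYstep : ∀ n, κ * η n * G n ^ 2 ≤ Y n - Y (n + 1) := by
    intro n
    have h1 : N (n + 1) = N n + a n := Finset.sum_range_succ _ _
    have := hdesc n
    simp only [hY, h1, hG]
    linarith
  have hYanti : Antitone Y := antitone_nat_of_succ_le fun n => by
    have := hYstep n
    have h2 : 0 ≤ κ * η n * G n ^ 2 := mul_nonneg (mul_nonneg hκ.le (hη n).le) (sq_nonneg _)
    linarith
  obtain ⟨y, hy⟩ : ∃ y, Tendsto Y atTop (𝓝 y) := by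
    refine ⟨_, tendsto_atTop_ciInf hYanti ?_⟩
    obtain ⟨B, hB⟩ := hbdd
    obtain ⟨B', hB'⟩ := hNl.bddAbove_range
    refine ⟨B - B' + l, ?_⟩
    rintro _ ⟨n, rfl⟩
    have h1 := hB ⟨θ n, rfl⟩
    have h2 := hB' ⟨n, rfl⟩
    simp only [hY]; linarith
  have hyle : ∀ n, y ≤ Y n := fun n => hYanti.le_of_tendsto hy n
  have hFy : Tendsto (fun n => F (θ n)) atTop (𝓝 y) := by
    have h := (hy.add hNl).sub_const l
    rw [add_sub_cancel_right] at h
    refine h.congr fun n => ?_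
    simp only [hY]; ring
  -- If the gradient stayed above `ε`, the decrease of `Y` would dominate `κ ε²` times the divergent
  -- sum of the steps, although `Y` is bounded below by `y`.
  have hfreq : ∀ ε > 0, ∃ᶠ n in atTop, G n < ε := by
    intro ε hε hcon
    simp only [not_lt] at hcon
    obtain ⟨n₀, hn₀⟩ := eventually_atTop.1 hcon
    have h1 : ∀ n ≥ n₀, κ * ε ^ 2 * (∑ k ∈ Finset.range n, η k - ∑ k ∈ Finset.range n₀, η k)
        ≤ Y n₀ - Y n := by
      intro n hn
      induction n, hn using Nat.le_induction with
      | base => simp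
      | succ n hn ih =>
        rw [Finset.sum_range_succ]
        have h2 := hYstep n
        have h3 : ε ^ 2 ≤ G n ^ 2 := pow_le_pow_left₀ hε.le (hn₀ n hn) 2
        have h4 := mul_le_mul_of_nonneg_left h3 (mul_nonneg hκ.le (hη n).le)
        linarith
    have h2 : Tendsto (fun n => κ * ε ^ 2 *
        (∑ k ∈ Finset.range n, η k - ∑ k ∈ Finset.range n₀, η k)) atTop atTop :=
      (tendsto_atTop_add_const_right _ _ hηtop).const_mul_atTop (by positivity)
    obtain ⟨n, hn, hn'⟩ := ((h2.eventually_gt_atTop (Y n₀ - y)).and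
      (eventually_ge_atTop n₀)).exists
    linarith [h1 n hn', hyle n]
  -- a critical accumulation point
  obtain ⟨φ, hφ, hφG⟩ : ∃ φ : ℕ → ℕ, StrictMono φ ∧ ∀ n : ℕ, G (φ n) < 1 / ((n : ℝ) + 1) :=
    extraction_forall_of_frequently fun n => hfreq _ (by positivity)
  obtain ⟨θs, -, ψ, hψ, hθs⟩ := tendsto_subseq_of_bounded hθ
    (fun n => (⟨φ n, rfl⟩ : θ (φ n) ∈ Set.range θ))
  have hφψ : Tendsto (φ ∘ ψ) atTop atTop := (hφ.comp hψ).tendsto_atTop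
  have hcrit : gradient F θs = 0 := by
    have h1 : Tendsto (fun n => G (φ (ψ n))) atTop (𝓝 ‖gradient F θs‖) :=
      ((hgc.tendsto θs).comp hθs).norm
    have h2 : Tendsto (fun n => G (φ (ψ n))) atTop (𝓝 0) :=
      squeeze_zero (fun _ => norm_nonneg _) (fun n => (hφG (ψ n)).le)
        (tendsto_one_div_add_atTop_nhds_zero_nat.comp hψ.tendsto_atTop)
    exact norm_eq_zero.1 (tendsto_nhds_unique h1 h2)
  have hFθs : F θs = y :=
    tendsto_nhds_unique ((hF.contDiff.continuous.tendsto θs).comp hθs) (hFy.comp hφψ)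
  have hqinv : 1 / q < 1 := by rw [div_lt_one (by linarith)]; exact hq
  -- The midpoint of `1 / q` and `1` is a lower bound for `β` that is below 1 and still forces `q *
  -- β > 1`.
  obtain ⟨δ, β, ζ, hδ, hβ0, hβ1, hββ, hζ, hball⟩ :=
    hF.exists_ball hcrit (β₁ := (1 + 1 / q) / 2) (by linarith)
  have hqβ : 1 < q * β := by
    have h1 : q * ((1 + 1 / q) / 2) = (q + 1) / 2 := by field_simp
    have h2 := mul_le_mul_of_nonneg_left hββ (by linarith : 0 ≤ q)
    linarith
  -- The price, raised to the power `β`, of replacing `F (θ n) - y` by `Y n - y` in the Łojasiewicz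
  -- inequality; subadditivity of `x ^ β` separates it from the main term.
  set e : ℕ → ℝ := fun n => (R * t n ^ (-q)) ^ β with he
  have he0 : ∀ n, 0 ≤ e n := fun n => Real.rpow_nonneg (mul_nonneg hR
    (Real.rpow_nonneg (tpos n).le _)) _
  have hsum : Summable (fun n => η n * e n) := by
    refine ((summable_mul_sum_rpow_neg hη hqβ).mul_left (R ^ β)).congr fun n => ?_
    simp only [he]
    rw [Real.mul_rpow hR (Real.rpow_nonneg (tpos n).le _), ← Real.rpow_mul (tpos n).le,
      neg_mul]
    ring
  set A := ζ / ((1 - β) * κ) with hA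
  -- A potential for the length of drift that remains: the Łojasiewicz term in `Y n - y` plus the
  -- tail of the error series. Inside the ball, each drift step is at most the decrease of `Φ`.
  set Φ : ℕ → ℝ := fun n => c * (A * (Y n - y) ^ (1 - β) + (∑' k, η (k + n) * e (k + n)) / ζ)
    with hΦ
  have hΦ0 : Tendsto Φ atTop (𝓝 0) := by
    have h1 : Tendsto (fun n => (Y n - y) ^ (1 - β)) atTop (𝓝 0) := by
      have h := (hy.sub_const y).rpow_const (p := 1 - β) (Or.inr (by linarith))
      rwa [sub_self, Real.zero_rpow (by linarith)] at h
    have h2 := tendsto_sum_nat_add (fun n => η n * e n)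
    have h3 := ((h1.const_mul A).add (h2.div_const ζ)).const_mul c
    simpa using h3
  have hΦnn : ∀ n, 0 ≤ Φ n := fun n => by
    refine mul_nonneg hc.le (add_nonneg (mul_nonneg ?_ (Real.rpow_nonneg
      (sub_nonneg.2 (hyle n)) _)) (div_nonneg (tsum_nonneg fun k =>
        mul_nonneg (hη _).le (he0 _)) hζ.le))
    exact div_nonneg hζ.le (mul_nonneg (by linarith) hκ.le)
  have hlen : ∀ n, θ n ∈ Metric.ball θs δ → c * (η n * G n) ≤ Φ n - Φ (n + 1) := by
    intro n hn
    have h1 : (Y n - y) ^ β ≤ ζ * G n + e n := by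
      have h2 := hball _ hn
      rw [hFθs] at h2
      have h3 : Y n - y ≤ |F (θ n) - y| + R * t n ^ (-q) := by
        have h4 := le_abs_self (F (θ n) - y)
        have h5 := neg_abs_le (N n - l)
        have h6 := hN n
        simp only [hY]
        linarith
      refine (Real.rpow_le_rpow (sub_nonneg.2 (hyle n)) h3 hβ0.le).trans ?_
      refine (Real.rpow_add_le_add_rpow (abs_nonneg _) (mul_nonneg hR
        (Real.rpow_nonneg (tpos n).le _)) hβ0.le hβ1.le).trans ?_
      exact add_le_add_left h2 _
    have h2 := mul_le_of_lojasiewicz (x' := Y (n + 1) - y) hβ0 hβ1 hκ (hη n) hζ (norm_nonneg _)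
      (he0 n) (sub_nonneg.2 (hyle _)) ((hYstep n).trans_eq (by ring)) h1
    have h3 : ∑' k, η (k + n) * e (k + n)
        = η n * e n + ∑' k, η (k + (n + 1)) * e (k + (n + 1)) := by
      have h := ((summable_nat_add_iff n).2 hsum).tsum_eq_zero_add
      simp only [zero_add] at h
      rw [h]
      congr 1
      refine tsum_congr fun k => ?_
      rw [add_assoc, add_comm 1 n]
    have h4 := mul_le_mul_of_nonneg_left h2 hc.le
    simp only [hΦ, h3]
    refine h4.trans (le_of_eq ?_)
    ring
  obtain ⟨x, hx⟩ := hD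
  set P : ℕ → Vec m := fun n => ∑ k ∈ Finset.range n, η k • D k with hP
  -- Adding the noise sums `P` back to the iterates leaves only the drift, so the length bound
  -- applies to `θ + P`.
  have hstep : ∀ n, θ n ∈ Metric.ball θs δ →
      ‖(θ (n + 1) + P (n + 1)) - (θ n + P n)‖ ≤ Φ n - Φ (n + 1) := by
    intro n hn
    have h1 : P (n + 1) = P n + η n • D n := Finset.sum_range_succ _ _
    have h2 : (θ (n + 1) + P (n + 1)) - (θ n + P n) = -(η n • b n) := by
      rw [h1, hrec n, smul_add]; abel
    rw [h2, norm_neg, norm_smul, Real.norm_of_nonneg (hη n).le]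
    refine le_trans ?_ (hlen n hn)
    have := mul_le_mul_of_nonneg_left (hb n) (hη n).le
    linarith
  have hPx : ∀ᶠ n in atTop, ‖P n - x‖ < δ / 6 := by
    have h := (tendsto_iff_norm_sub_tendsto_zero.1 hx)
    exact h.eventually (gt_mem_nhds (by positivity))
  obtain ⟨n₁, hn₁⟩ := eventually_atTop.1 hPx
  -- Budget for staying in the ball: `δ / 3` for the initial distance, `δ / 3` for the drift, and `δ
  -- / 6` for each of the noise discrepancies `P M - x` and `P (n + 1) - x`.
  obtain ⟨M, hM⟩ : ∃ M, M ≥ n₁ ∧ Φ M < δ / 3 ∧ ‖θ M - θs‖ < δ / 3 := by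
    have h1 := hφψ.eventually (eventually_ge_atTop n₁)
    have h2 := hφψ.eventually (hΦ0.eventually (gt_mem_nhds (by positivity : (0:ℝ) < δ / 3)))
    have h3 := (tendsto_iff_norm_sub_tendsto_zero.1 hθs).eventually
      (gt_mem_nhds (by positivity : (0:ℝ) < δ / 3))
    obtain ⟨k, hk⟩ := (h1.and (h2.and h3)).exists
    exact ⟨φ (ψ k), hk⟩
  obtain ⟨hM1, hM2, hM3⟩ := hM
  have hstay : ∀ n ≥ M, θ n ∈ Metric.ball θs δ ∧
      ‖(θ n + P n) - (θ M + P M)‖ ≤ Φ M - Φ n := by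
    intro n hn
    induction n, hn using Nat.le_induction with
    | base =>
      refine ⟨?_, by simp⟩
      rw [mem_ball_iff_norm]; linarith
    | succ n hn ih =>
      have h1 : ‖(θ (n + 1) + P (n + 1)) - (θ M + P M)‖ ≤ Φ M - Φ (n + 1) := by
        have h := norm_sub_le_norm_sub_add_norm_sub (θ (n + 1) + P (n + 1)) (θ n + P n)
          (θ M + P M)
        linarith [hstep n ih.1, ih.2]
      refine ⟨?_, h1⟩
      rw [mem_ball_iff_norm]
      have h2 : θ (n + 1) - θs = ((θ (n + 1) + P (n + 1)) - (θ M + P M)) - (P (n + 1) - x)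
          + (P M - x) + (θ M - θs) := by abel
      rw [h2]
      have h3 := hn₁ (n + 1) (by omega)
      have h4 := hn₁ M hM1
      have h5 := hΦnn (n + 1)
      refine (norm_add_le _ _).trans_lt ?_
      have h6 := norm_add_le ((θ (n + 1) + P (n + 1)) - (θ M + P M) - (P (n + 1) - x)) (P M - x)
      have h7 := norm_sub_le ((θ (n + 1) + P (n + 1)) - (θ M + P M)) (P (n + 1) - x)
      linarith
  have hQ : CauchySeq (fun n => θ (n + M) + P (n + M)) := by
    refine cauchySeq_of_le_tendsto_0' (fun n => Φ (n + M)) (fun i j hij => ?_)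
      (hΦ0.comp (tendsto_add_atTop_nat M))
    rw [dist_comm, dist_eq_norm]
    have h : ‖(θ (j + M) + P (j + M)) - (θ (i + M) + P (i + M))‖ ≤ Φ (i + M) - Φ (j + M) := by
      induction j, hij using Nat.le_induction with
      | base => simp
      | succ j hj ih =>
        have h1 := hstep (j + M) (hstay (j + M) (by omega)).1
        rw [show j + 1 + M = j + M + 1 by ring]
        have h2 := norm_sub_le_norm_sub_add_norm_sub (θ (j + M + 1) + P (j + M + 1))
          (θ (j + M) + P (j + M)) (θ (i + M) + P (i + M))
        linarith
    exact h.trans (sub_le_self _ (hΦnn _))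
  obtain ⟨z, hz⟩ := cauchySeq_tendsto_of_complete hQ
  have hz' : Tendsto (fun n => θ n + P n) atTop (𝓝 z) :=
    (tendsto_add_atTop_iff_nat (f := fun n => θ n + P n) M).1 hz
  have hθz : Tendsto θ atTop (𝓝 (z - x)) := by
    refine (hz'.sub hx).congr fun n => ?_
    simp
  have : z - x = θs := tendsto_nhds_unique (hθz.comp hφψ) hθs
  exact ⟨θs, this ▸ hθz, hcrit⟩

/-! ### Independence and conditional expectations -/

section Independence

variable {Ω : Type*} {m₀ : MeasurableSpace Ω} [mΩ : MeasurableSpace Ω] {P : Measure Ω}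
  [IsProbabilityMeasure P]

/-- Associativity of product measures: the joint law of the triple factors completely, and can be
regrouped. -/
lemma indepFun_prodMk_of_indepFun {β γ δ : Type*} [MeasurableSpace β] [MeasurableSpace γ]
    [MeasurableSpace δ] {X : Ω → β} {Y : Ω → γ} {Z : Ω → δ} (hX : Measurable X)
    (hY : Measurable Y) (hZ : Measurable Z) (h1 : IndepFun X (fun ω => (Y ω, Z ω)) P)
    (h2 : IndepFun Y Z P) : IndepFun (fun ω => (X ω, Y ω)) Z P := by
  have : IsProbabilityMeasure (P.map X) := Measure.isProbabilityMeasure_map hX.aemeasurable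
  have : IsProbabilityMeasure (P.map Y) := Measure.isProbabilityMeasure_map hY.aemeasurable
  have : IsProbabilityMeasure (P.map Z) := Measure.isProbabilityMeasure_map hZ.aemeasurable
  have h3 : IndepFun X Y P := h1.comp measurable_id measurable_fst
  rw [indepFun_iff_map_prod_eq_prod_map_map (by fun_prop) (by fun_prop)] at h1 h2 h3 ⊢
  rw [h3]
  rw [h2] at h1
  have h4 : P.map (fun ω => ((X ω, Y ω), Z ω))
      = (P.map (fun ω => (X ω, Y ω, Z ω))).map MeasurableEquiv.prodAssoc.symm := by
    rw [Measure.map_map (MeasurableEquiv.measurable _) (by fun_prop)]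
    rfl
  rw [h4, h1, ← Measure.prodAssoc_prod, Measure.map_map (MeasurableEquiv.measurable _)
    (MeasurableEquiv.measurable _)]
  simp

lemma map_prodMk_of_indep {β δ : Type*} [MeasurableSpace β] [MeasurableSpace δ]
    (hm : m₀ ≤ mΩ) {Y : Ω → β} {Z : Ω → δ} (hY : Measurable[m₀] Y)
    (hZ : Measurable Z) (hind : Indep (MeasurableSpace.comap Z inferInstance) m₀ P) :
    P.map (fun ω => (Y ω, Z ω)) = (P.map Y).prod (P.map Z) := by
  refine (indepFun_iff_map_prod_eq_prod_map_map (hY.mono hm le_rfl).aemeasurable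
    hZ.aemeasurable).1 ?_
  rw [IndepFun_iff_Indep]
  exact indep_of_indep_of_le_left hind.symm hY.comap_le

/-- The freezing lemma: a known variable is held fixed while the independent one is integrated out.
-/
lemma condExp_comp_of_indep {β δ : Type*} [MeasurableSpace β] [MeasurableSpace δ]
    (hm : m₀ ≤ mΩ) {Y : Ω → β} {Z : Ω → δ} (hY : Measurable[m₀] Y)
    (hZ : Measurable Z) (hind : Indep (MeasurableSpace.comap Z inferInstance) m₀ P)
    {φ : β × δ → ℝ} (hφ : Measurable φ) (hint : Integrable (fun ω => φ (Y ω, Z ω)) P) :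
    P[fun ω => φ (Y ω, Z ω) | m₀] =ᵐ[P] fun ω => ∫ z, φ (Y ω, z) ∂(P.map Z) := by
  have hY' : Measurable Y := hY.mono hm le_rfl
  have hpZ : IsProbabilityMeasure (P.map Z) := Measure.isProbabilityMeasure_map hZ.aemeasurable
  have hpY : IsProbabilityMeasure (P.map Y) := Measure.isProbabilityMeasure_map hY'.aemeasurable
  have hΦ : StronglyMeasurable (fun y => ∫ z, φ (y, z) ∂(P.map Z)) :=
    hφ.stronglyMeasurable.integral_prod_right'
  have hprod : Integrable φ ((P.map Y).prod (P.map Z)) := by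
    rw [← map_prodMk_of_indep hm hY hZ hind, integrable_map_measure
      hφ.aestronglyMeasurable (hY'.prodMk hZ).aemeasurable]
    exact hint
  have hΦint : Integrable (fun ω => ∫ z, φ (Y ω, z) ∂(P.map Z)) P := by
    have := hprod.integral_prod_left
    rwa [integrable_map_measure hΦ.aestronglyMeasurable hY'.aemeasurable] at this
  refine (ae_eq_condExp_of_forall_setIntegral_eq hm hint (fun _ _ _ => hΦint.integrableOn)
    (fun s hs _ => ?_) (hΦ.comp_measurable hY).aestronglyMeasurable).symm
  have hs' := hm s hs
  -- Attaching the indicator of `s` to `Y` keeps the pair `m₀`-measurable, so `W` is still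
  -- independent of `Z`; the integral over `s` becomes an integral over `Ω` to which Fubini applies.
  set W : Ω → ℝ × β := fun ω => (s.indicator 1 ω, Y ω) with hW
  have hWm : Measurable[m₀] W :=
    ((measurable_const : Measurable[m₀] fun _ : Ω => (1 : ℝ)).indicator hs).prodMk hY
  have hW' : Measurable W := hWm.mono hm le_rfl
  have hpW : IsProbabilityMeasure (P.map W) := Measure.isProbabilityMeasure_map hW'.aemeasurable
  set χ : (ℝ × β) × δ → ℝ := fun p => p.1.1 * φ (p.1.2, p.2) with hχ
  have hχm : Measurable χ := by fun_prop
  have hWint : Integrable (fun ω => χ (W ω, Z ω)) P := by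
    refine (hint.indicator hs').congr (Eventually.of_forall fun ω => ?_)
    by_cases h : ω ∈ s <;> simp [hχ, hW, h]
  have hχint : Integrable χ ((P.map W).prod (P.map Z)) := by
    rw [← map_prodMk_of_indep hm hWm hZ hind, integrable_map_measure
      hχm.aestronglyMeasurable (hW'.prodMk hZ).aemeasurable]
    exact hWint
  have e1 : ∫ ω in s, φ (Y ω, Z ω) ∂P = ∫ ω, χ (W ω, Z ω) ∂P := by
    rw [← integral_indicator hs']
    refine integral_congr_ae (Eventually.of_forall fun ω => ?_)
    by_cases h : ω ∈ s <;> simp [hχ, hW, h]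
  have e2 : ∫ ω, χ (W ω, Z ω) ∂P = ∫ w, ∫ z, χ (w, z) ∂(P.map Z) ∂(P.map W) := by
    rw [← integral_prod χ hχint, ← map_prodMk_of_indep hm hWm hZ hind,
      integral_map (hW'.prodMk hZ).aemeasurable hχm.aestronglyMeasurable]
  have e3 : ∫ w, ∫ z, χ (w, z) ∂(P.map Z) ∂(P.map W)
      = ∫ ω in s, (∫ z, φ (Y ω, z) ∂(P.map Z)) ∂P := by
    rw [integral_map hW'.aemeasurable
      hχm.stronglyMeasurable.integral_prod_right'.aestronglyMeasurable, ← integral_indicator hs']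
    refine integral_congr_ae (Eventually.of_forall fun ω => ?_)
    by_cases h : ω ∈ s <;> simp [hχ, hW, h]
  rw [e1, e2, e3]

end Independence

/-! ### Processes driven by independent innovations -/

/-- `θ` is adapted to `ℱ`, and `Z k` has law `ν`, is independent of `ℱ k` and known at time
`k + 1`. -/
structure IsDriven {Ω E S : Type*} [mΩ : MeasurableSpace Ω] [MeasurableSpace E]
    [MeasurableSpace S] (P : Measure Ω) (ν : Measure S) (ℱ : Filtration ℕ mΩ) (θ : ℕ → Ω → E)
    (Z : ℕ → Ω → S) : Prop where
  adapted : ∀ k, Measurable[ℱ k] (θ k)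
  adapted_succ : ∀ k, Measurable[ℱ (k + 1)] (Z k)
  indep : ∀ k, Indep (MeasurableSpace.comap (Z k) inferInstance) (ℱ k) P
  map_eq : ∀ k, P.map (Z k) = ν

namespace IsDriven

variable {Ω E S : Type*} [mΩ : MeasurableSpace Ω] [MeasurableSpace E] [MeasurableSpace S]
  {P : Measure Ω} {ν : Measure S} {ℱ : Filtration ℕ mΩ}
  {θ : ℕ → Ω → E} {Z : ℕ → Ω → S}

lemma measurable (h : IsDriven P ν ℱ θ Z) (k : ℕ) : Measurable (θ k) :=
  (h.adapted k).mono (ℱ.le k) le_rfl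

lemma measurable_innovation (h : IsDriven P ν ℱ θ Z) (k : ℕ) : Measurable (Z k) :=
  (h.adapted_succ k).mono (ℱ.le _) le_rfl

variable [IsProbabilityMeasure P]

lemma condExp (h : IsDriven P ν ℱ θ Z) {φ : E × S → ℝ} (hφ : Measurable φ) {k : ℕ}
    (hint : Integrable (fun ω => φ (θ k ω, Z k ω)) P) :
    P[fun ω => φ (θ k ω, Z k ω) | ℱ k] =ᵐ[P] fun ω => ∫ z, φ (θ k ω, z) ∂ν := by
  rw [← h.map_eq k]
  exact condExp_comp_of_indep (ℱ.le k) (h.adapted k) (h.measurable_innovation k) (h.indep k) hφ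
    hint

/-- The version of the freezing identity that presupposes no integrability; second moments along the
process are shown to be finite with it. -/
lemma lintegral (h : IsDriven P ν ℱ θ Z) {φ : E × S → ENNReal} (hφ : Measurable φ) (k : ℕ) :
    ∫⁻ ω, φ (θ k ω, Z k ω) ∂P = ∫⁻ ω, ∫⁻ z, φ (θ k ω, z) ∂ν ∂P := by
  have hZ := h.measurable_innovation k
  have hθ := h.measurable k
  have : IsProbabilityMeasure (P.map (Z k)) := Measure.isProbabilityMeasure_map hZ.aemeasurable
  rw [← h.map_eq k, ← lintegral_map hφ (hθ.prodMk hZ),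
    map_prodMk_of_indep (ℱ.le k) (h.adapted k) hZ (h.indep k), lintegral_prod _ hφ.aemeasurable,
    lintegral_map hφ.lintegral_prod_right' hθ]

/-- Convergence of square integrable martingale transforms. -/
theorem ae_exists_tendsto_sum (h : IsDriven P ν ℱ θ Z) {ψ : E × S → ℝ} (hψ : Measurable ψ)
    {B : ℝ} (hB : 0 ≤ B) (hmean : ∀ x, ∫ z, ψ (x, z) ∂ν = 0)
    (hvar : ∀ x, ∫⁻ z, ENNReal.ofReal (ψ (x, z) ^ 2) ∂ν ≤ ENNReal.ofReal B) {w : ℕ → ℝ}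
    (hw : Summable (fun k => w k ^ 2)) :
    ∀ᵐ ω ∂P, ∃ x, Tendsto (fun n => ∑ k ∈ Finset.range n, w k * ψ (θ k ω, Z k ω))
      atTop (𝓝 x) := by
  set X : ℕ → Ω → ℝ := fun k ω => ψ (θ k ω, Z k ω) with hX
  have hXm : ∀ k, Measurable (X k) := fun k =>
    hψ.comp ((h.measurable k).prodMk (h.measurable_innovation k))
  have hXa : ∀ k, Measurable[ℱ (k + 1)] (X k) := fun k =>
    hψ.comp (Measurable.prodMk ((h.adapted k).mono (ℱ.mono k.le_succ) le_rfl) (h.adapted_succ k))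
  have hX2 : ∀ k, ∫⁻ ω, ENNReal.ofReal (X k ω ^ 2) ∂P ≤ ENNReal.ofReal B := by
    intro k
    have := h.lintegral (φ := fun p => ENNReal.ofReal (ψ p ^ 2)) (by fun_prop) k
    rw [this]
    refine (lintegral_mono fun ω => hvar _).trans ?_
    simp
  have hXsq : ∀ k, Integrable (fun ω => X k ω ^ 2) P := by
    intro k
    refine ⟨((hXm k).pow_const 2).aestronglyMeasurable, ?_⟩
    rw [hasFiniteIntegral_iff_ofReal (Eventually.of_forall fun ω => sq_nonneg _)]
    exact (hX2 k).trans_lt ENNReal.ofReal_lt_top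
  have hXL : ∀ k, MemLp (X k) 2 P := fun k =>
    (memLp_two_iff_integrable_sq (hXm k).aestronglyMeasurable).2 (hXsq k)
  have hXB : ∀ k, ∫ ω, X k ω ^ 2 ∂P ≤ B := by
    intro k
    rw [integral_eq_lintegral_of_nonneg_ae (Eventually.of_forall fun ω => sq_nonneg _)
      (hXsq k).aestronglyMeasurable]
    exact ENNReal.toReal_le_of_le_ofReal hB (hX2 k)
  have hXc : ∀ k, P[X k | ℱ k] =ᵐ[P] 0 := fun k =>
    (h.condExp hψ ((hXL k).integrable one_le_two)).trans
      (Eventually.of_forall fun ω => hmean _)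
  set M : ℕ → Ω → ℝ := fun n ω => ∑ k ∈ Finset.range n, w k * X k ω with hM
  have hMsucc : ∀ n, M (n + 1) = fun ω => M n ω + w n * X n ω := fun n => by
    funext ω; exact Finset.sum_range_succ _ _
  have hMa : ∀ n, Measurable[ℱ n] (M n) := by
    intro n
    refine Finset.measurable_fun_sum _ fun k hk => ?_
    exact ((hXa k).mono (ℱ.mono (Finset.mem_range.1 hk)) le_rfl).const_mul _
  have hML : ∀ n, MemLp (M n) 2 P := by
    intro n
    exact memLp_finsetSum _ fun k _ => (hXL k).const_mul (w k)
  have hmart : Martingale M ℱ P := by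
    refine martingale_of_condExp_sub_eq_zero_nat (fun n => (hMa n).stronglyMeasurable)
      (fun n => (hML n).integrable one_le_two) fun n => ?_
    have h1 : M (n + 1) - M n = w n • X n := by
      rw [hMsucc]; funext ω; simp
    rw [h1]
    refine (condExp_smul _ _ _).trans ?_
    filter_upwards [hXc n] with ω hω
    simp [hω]
  -- Orthogonality of martingale increments, so that the second moments of `M` add up.
  have hcross : ∀ n, ∫ ω, M n ω * X n ω ∂P = 0 := by
    intro n
    have hi : Integrable (M n * X n) P := (hML n).integrable_mul (hXL n)
    have h1 := condExp_mul_of_stronglyMeasurable_left (hMa n).stronglyMeasurable hi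
      ((hXL n).integrable one_le_two)
    have h2 : ∫ ω, (M n * X n) ω ∂P = ∫ ω, (P[M n * X n | ℱ n]) ω ∂P :=
      (integral_condExp (ℱ.le n)).symm
    refine h2.trans ?_
    rw [integral_congr_ae (g := fun _ => (0 : ℝ)), integral_zero]
    filter_upwards [h1, hXc n] with ω h3 h4
    rw [h3, Pi.mul_apply, h4]; simp
  have hMsq : ∀ n, ∫ ω, M n ω ^ 2 ∂P ≤ B * ∑ k ∈ Finset.range n, w k ^ 2 := by
    intro n
    induction n with
    | zero => simp [hM]
    | succ n ih =>
      have h1 : ∫ ω, M (n + 1) ω ^ 2 ∂P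
          = ∫ ω, M n ω ^ 2 ∂P + (2 * w n) * ∫ ω, M n ω * X n ω ∂P
            + w n ^ 2 * ∫ ω, X n ω ^ 2 ∂P := by
        have i1 : Integrable (fun ω => M n ω ^ 2) P := (hML n).integrable_sq
        have i2 : Integrable (fun ω => (2 * w n) * (M n ω * X n ω)) P :=
          ((hML n).integrable_mul (hXL n)).const_mul _
        have i12 : Integrable (fun ω => M n ω ^ 2 + (2 * w n) * (M n ω * X n ω)) P := i1.add i2
        have i3 : Integrable (fun ω => w n ^ 2 * X n ω ^ 2) P := (hXsq n).const_mul _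
        rw [← integral_const_mul, ← integral_const_mul, ← integral_add i1 i2,
          ← integral_add i12 i3]
        refine integral_congr_ae (Eventually.of_forall fun ω => ?_)
        simp only [hMsucc]
        ring
      rw [h1, hcross, Finset.sum_range_succ]
      have := mul_le_mul_of_nonneg_left (hXB n) (sq_nonneg (w n))
      linarith
  -- The `L²` bound gives the `L¹` bound required here through `|x| ≤ 1 + x²`, which explains the
  -- constant `R`.
  refine hmart.submartingale.exists_ae_tendsto_of_bdd
    (R := (1 + B * ∑' k, w k ^ 2).toNNReal) fun n => ?_
  rw [eLpNorm_one_eq_lintegral_enorm,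
    ← ofReal_integral_norm_eq_lintegral_enorm ((hML n).integrable one_le_two)]
  refine ENNReal.ofReal_le_ofReal ?_
  have h1 : ∫ ω, ‖M n ω‖ ∂P ≤ ∫ ω, (1 + M n ω ^ 2) ∂P := by
    refine integral_mono ((hML n).integrable one_le_two).norm
      ((integrable_const _).add (hML n).integrable_sq) fun ω => ?_
    rw [Real.norm_eq_abs]
    nlinarith [sq_abs (M n ω), sq_nonneg (|M n ω| - 1)]
  rw [integral_add (integrable_const _) (hML n).integrable_sq] at h1
  have h2 := mul_le_mul_of_nonneg_left
    (hw.sum_le_tsum (Finset.range n) fun k _ => sq_nonneg (w k)) hB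
  have h3 := hMsq n
  simp only [integral_const, probReal_univ, smul_eq_mul, mul_one] at h1
  linarith

end IsDriven

/-- Nonnegative almost supermartingales are bounded, almost surely and in mean. -/
theorem bdd_of_almost_supermartingale {Ω : Type*} [mΩ : MeasurableSpace Ω] {P : Measure Ω}
    [IsProbabilityMeasure P] {ℱ : Filtration ℕ mΩ} {V : ℕ → Ω → ℝ} {p : ℕ → ℝ}
    (hadp : ∀ k, Measurable[ℱ k] (V k)) (hint : ∀ k, Integrable (V k) P) (hnn : ∀ k ω, 0 ≤ V k ω)
    (hp : ∀ k, 0 ≤ p k) (hps : Summable p)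
    (hV : ∀ k, P[V (k + 1) | ℱ k] ≤ᵐ[P] fun ω => (1 + p k) * V k ω) :
    (∀ᵐ ω ∂P, BddAbove (Set.range fun k => V k ω)) ∧ ∃ R, ∀ k, ∫ ω, V k ω ∂P ≤ R := by
  set q : ℕ → ℝ := fun k => ∏ j ∈ Finset.range k, (1 + p j) with hq
  have hqpos : ∀ k, 0 < q k := fun k => Finset.prod_pos fun j _ => by linarith [hp j]
  have hqsucc : ∀ k, q (k + 1) = q k * (1 + p k) := fun k => Finset.prod_range_succ _ _
  have hqle : ∀ k, q k ≤ Real.exp (∑' j, p j) := by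
    intro k
    calc q k ≤ ∏ j ∈ Finset.range k, Real.exp (p j) :=
          Finset.prod_le_prod (fun j _ => by linarith [hp j]) fun j _ => by
            linarith [Real.add_one_le_exp (p j)]
      _ = Real.exp (∑ j ∈ Finset.range k, p j) := (Real.exp_sum _ _).symm
      _ ≤ _ := Real.exp_le_exp.2 (hps.sum_le_tsum _ fun j _ => hp j)
  -- Dividing by the accumulated factors `q k` yields a true supermartingale; `q` is bounded since
  -- `p` is summable, so bounds on `U` carry over to `V`.
  set U : ℕ → Ω → ℝ := fun k => (q k)⁻¹ • V k with hU
  have hUint : ∀ k, Integrable (U k) P := fun k => (hint k).smul _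
  have hUnn : ∀ k ω, 0 ≤ U k ω := fun k ω => mul_nonneg (inv_nonneg.2 (hqpos k).le) (hnn k ω)
  have hsup : Supermartingale U ℱ P := by
    refine supermartingale_nat (fun k => ((hadp k).const_smul _).stronglyMeasurable) hUint
      fun k => ?_
    filter_upwards [condExp_smul (μ := P) (q (k + 1))⁻¹ (V (k + 1)) (ℱ k), hV k] with ω h1 h2
    simp only [hU]
    rw [h1, Pi.smul_apply, Pi.smul_apply, smul_eq_mul, smul_eq_mul]
    refine (mul_le_mul_of_nonneg_left h2 (inv_nonneg.2 (hqpos _).le)).trans (le_of_eq ?_)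
    have h3 : (1 + p k) ≠ 0 := by linarith [hp k]
    rw [hqsucc, mul_inv, mul_assoc, inv_mul_cancel_left₀ h3]
  have hUmean : ∀ k, ∫ ω, U k ω ∂P ≤ ∫ ω, U 0 ω ∂P := by
    intro k
    have := hsup.setIntegral_le k.zero_le MeasurableSet.univ
    simpa using this
  have hconv : ∀ᵐ ω ∂P, ∃ x, Tendsto (fun n => (-U) n ω) atTop (𝓝 x) := by
    refine hsup.neg.exists_ae_tendsto_of_bdd (R := (∫ ω, U 0 ω ∂P).toNNReal) fun n => ?_
    rw [Pi.neg_apply, eLpNorm_neg, eLpNorm_one_eq_lintegral_enorm,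
      ← ofReal_integral_norm_eq_lintegral_enorm (hUint n)]
    refine ENNReal.ofReal_le_ofReal (le_trans (le_of_eq ?_) (hUmean n))
    exact integral_congr_ae (Eventually.of_forall fun ω => Real.norm_of_nonneg (hUnn n ω))
  have hVU : ∀ k ω, V k ω = q k * U k ω := fun k ω => by
    simp [hU, mul_inv_cancel_left₀ (hqpos k).ne']
  refine ⟨?_, Real.exp (∑' j, p j) * ∫ ω, U 0 ω ∂P, fun k => ?_⟩
  · filter_upwards [hconv] with ω ⟨x, hx⟩
    obtain ⟨B, hB⟩ := hx.neg.bddAbove_range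
    refine ⟨Real.exp (∑' j, p j) * B, ?_⟩
    rintro _ ⟨k, rfl⟩
    have h1 : U k ω ≤ B := by simpa using hB ⟨k, rfl⟩
    simp only [hVU]
    exact mul_le_mul (hqle k) h1 (hUnn k ω) (Real.exp_pos _).le
  · simp only [hVU]
    rw [integral_const_mul]
    exact mul_le_mul (hqle k) (hUmean k) (integral_nonneg (hUnn k)) (Real.exp_pos _).le

/-! ### The objective -/

section Objective

variable {m : ℕ} {F : Vec m → ℝ} {L α : ℝ}

/-- The excess `F - inf F + 1`. -/
noncomputable def excess (F : Vec m → ℝ) (θ : Vec m) : ℝ := F θ - (⨅ ϑ, F ϑ) + 1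

lemma HolderSmooth.one_le_excess (h : HolderSmooth F L α) (θ : Vec m) : 1 ≤ excess F θ := by
  have := ciInf_le h.bddBelow θ
  unfold excess; linarith

lemma HolderSmooth.measurable_excess (h : HolderSmooth F L α) : Measurable (excess F) :=
  (h.differentiable.continuous.measurable.sub_const _).add_const _

/-- Mean value inequality on the segment for `F` minus its linearization at `x`. The sharp constant
`L / (1 + α)` is not needed. -/
lemma HolderSmooth.descent (h : HolderSmooth F L α) (x y : Vec m) :
    F y ≤ F x + inner ℝ (gradient F x) (y - x) + L * ‖y - x‖ ^ (1 + α) := by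
  have hα := h.α_pos
  have h1 := (convex_segment x y).norm_image_sub_le_of_norm_fderiv_le' (f := F) (𝕜 := ℝ)
    (φ := fderiv ℝ F x) (C := L * ‖y - x‖ ^ α) (fun z _ => h.differentiable z)
    (fun z hz => ?_) (left_mem_segment ℝ x y) (right_mem_segment ℝ x y)
  · have h2 : fderiv ℝ F x (y - x) = inner ℝ (gradient F x) (y - x) := by
      rw [gradient, InnerProductSpace.toDual_symm_apply]
    rw [h2] at h1
    have h3 : L * ‖y - x‖ ^ α * ‖y - x‖ = L * ‖y - x‖ ^ (1 + α) := by
      rw [add_comm 1 α, Real.rpow_add_of_nonneg (norm_nonneg _) hα.le zero_le_one,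
        Real.rpow_one, mul_assoc]
    have h4 := (le_abs_self _).trans h1
    linarith
  · have h2 : ‖fderiv ℝ F z - fderiv ℝ F x‖ = ‖gradient F z - gradient F x‖ := by
      rw [gradient, gradient, ← map_sub, LinearIsometryEquiv.norm_map]
    rw [h2]
    refine (h.holder x z).trans ?_
    have h3 : ‖z - x‖ ≤ ‖y - x‖ := norm_sub_le_of_mem_segment hz
    exact mul_le_mul_of_nonneg_left (Real.rpow_le_rpow (norm_nonneg _) h3 hα.le) h.L_pos.le

/-- Lets the second moment of the oracle control the power `1 + α` from the descent inequality. -/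
lemma rpow_one_add_le {x α : ℝ} (hx : 0 ≤ x) (hα0 : 0 < α) (hα1 : α ≤ 1) :
    x ^ (1 + α) ≤ 1 + x ^ 2 := by
  rcases le_total x 1 with h | h
  · have := Real.rpow_le_one hx h (by linarith : 0 ≤ 1 + α)
    nlinarith [sq_nonneg x]
  · have h1 := Real.rpow_le_rpow_of_exponent_le h (by linarith : 1 + α ≤ 2)
    rw [Real.rpow_two] at h1
    linarith

/-- The descent inequality from the origin gives at most quadratic growth, so square integrable
iterates have an integrable objective. -/
lemma HolderSmooth.exists_excess_le (h : HolderSmooth F L α) :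
    ∃ K, ∀ θ, excess F θ ≤ K * (1 + ‖θ‖ ^ 2) := by
  refine ⟨excess F 0 + ‖gradient F 0‖ + L, fun θ => ?_⟩
  have h1 := h.descent 0 θ
  rw [sub_zero] at h1
  have h2 := real_inner_le_norm (gradient F 0) θ
  have h3 := mul_le_mul_of_nonneg_left
    (rpow_one_add_le (norm_nonneg θ) h.α_pos h.α_le_one) h.L_pos.le
  have h4 : ‖θ‖ ≤ 1 + ‖θ‖ ^ 2 := by nlinarith [sq_nonneg (‖θ‖ - 1)]
  have h5 := mul_le_mul_of_nonneg_left h4 (norm_nonneg (gradient F 0))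
  have h6 := mul_nonneg (zero_le_one.trans (h.one_le_excess 0)) (sq_nonneg ‖θ‖)
  unfold excess at *
  linarith

lemma HolderSmooth.exists_norm_gradient_le (h : HolderSmooth F L α) :
    ∃ K, 0 ≤ K ∧ ∀ θ, ‖gradient F θ‖ ≤ K * (1 + ‖θ‖) := by
  refine ⟨‖gradient F 0‖ + L, by have := h.L_pos; positivity, fun θ => ?_⟩
  have h1 := h.holder 0 θ
  rw [sub_zero] at h1
  have h2 := norm_le_norm_sub_add (gradient F θ) (gradient F 0)
  have h3 : ‖θ‖ ^ α ≤ 1 + ‖θ‖ := by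
    refine (Real.rpow_le_rpow (norm_nonneg _) (by linarith : ‖θ‖ ≤ 1 + ‖θ‖) h.α_pos.le).trans ?_
    refine (Real.rpow_le_rpow_of_exponent_le (by linarith [norm_nonneg θ]) h.α_le_one).trans ?_
    rw [Real.rpow_one]
  have h4 := mul_le_mul_of_nonneg_left h3 h.L_pos.le
  have h5 := mul_nonneg (norm_nonneg (gradient F 0)) (norm_nonneg θ)
  linarith

lemma Coercive.exists_norm_le (h : Coercive F) (K : ℝ) :
    ∃ R, 0 ≤ R ∧ ∀ θ, excess F θ ≤ K → ‖θ‖ ≤ R := by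
  have h1 := h.eventually (eventually_gt_atTop (K + ⨅ ϑ, F ϑ))
  have h2 : Bornology.IsBounded {θ | F θ > K + ⨅ ϑ, F ϑ}ᶜ :=
    Bornology.isBounded_def.2 (by rwa [compl_compl])
  obtain ⟨R, hR, hR'⟩ := h2.exists_pos_norm_le
  refine ⟨R, hR.le, fun θ hθ => hR' θ ?_⟩
  simp only [Set.mem_compl_iff, Set.mem_ofPred_eq, not_lt]
  unfold excess at hθ
  linarith

end Objective

/-! ### The oracle -/

section Oracle

variable {d m : ℕ} {F : Vec m → ℝ} {L α C : ℝ} {g : Vec d → Vec m → Vec m}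
  {ν : Measure (Vec d)}

lemma measurable_integral_oracle [SFinite ν]
    (hg : Measurable (fun p : Vec d × Vec m => g p.1 p.2)) :
    Measurable (fun θ => ∫ z, g z θ ∂ν) := by
  have h : Measurable (fun p : Vec m × Vec d => g p.2 p.1) := hg.comp measurable_swap
  exact h.stronglyMeasurable.integral_prod_right'.measurable

variable {Ω : Type*} [mΩ : MeasurableSpace Ω] {P : Measure Ω} [IsProbabilityMeasure P]
  {ℱ : Filtration ℕ mΩ} {θ : ℕ → Ω → Vec m} {Z : ℕ → Ω → Vec d} {η : ℕ → ℝ}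

lemma HolderSmooth.integrable_excess (h : HolderSmooth F L α) {Y : Ω → Vec m}
    (hY : MemLp Y 2 P) : Integrable (fun ω => excess F (Y ω)) P := by
  obtain ⟨K, hK⟩ := h.exists_excess_le
  have h1 : Integrable (fun ω => ‖Y ω‖ ^ 2) P := hY.integrable_norm_pow two_ne_zero
  refine (((integrable_const 1).add h1).const_mul K).mono'
    (h.measurable_excess.comp_aemeasurable hY.1.aemeasurable).aestronglyMeasurable
    (Eventually.of_forall fun ω => ?_)
  rw [Real.norm_of_nonneg (zero_le_one.trans (h.one_le_excess _))]
  exact hK _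

/-- Freezing the iterate turns the pointwise second moment condition into one along the process. -/
lemma memLp_oracle_and_integral_le (hg : Measurable (fun p : Vec d × Vec m => g p.1 p.2))
    (hF : HolderSmooth F L α) (hC0 : 0 ≤ C) (hL2 : ∀ θ, MemLp (fun z => g z θ) 2 ν)
    (hC : ∀ θ, ∫ z, ‖g z θ‖ ^ 2 ∂ν ≤ C * excess F θ)
    (hdr : IsDriven P ν ℱ θ Z) {k : ℕ} (hk : MemLp (θ k) 2 P) :
    MemLp (fun ω => g (Z k ω) (θ k ω)) 2 P ∧
      ∫ ω, ‖g (Z k ω) (θ k ω)‖ ^ 2 ∂P ≤ C * ∫ ω, excess F (θ k ω) ∂P := by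
  have hgm : Measurable (fun ω => g (Z k ω) (θ k ω)) :=
    hg.comp ((hdr.measurable_innovation k).prodMk (hdr.measurable k))
  have hVi := hF.integrable_excess hk
  have hVnn : ∀ x, 0 ≤ C * excess F x := fun x =>
    mul_nonneg hC0 (zero_le_one.trans (hF.one_le_excess x))
  have h1 : ∫⁻ ω, ENNReal.ofReal (‖g (Z k ω) (θ k ω)‖ ^ 2) ∂P
      ≤ ENNReal.ofReal (C * ∫ ω, excess F (θ k ω) ∂P) := by
    rw [hdr.lintegral (φ := fun p => ENNReal.ofReal (‖g p.2 p.1‖ ^ 2))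
      (((hg.comp measurable_swap).norm.pow_const 2).ennreal_ofReal) k, ← integral_const_mul,
      ofReal_integral_eq_lintegral_ofReal (hVi.const_mul C) (Eventually.of_forall fun ω => hVnn _)]
    refine lintegral_mono fun ω => ?_
    rw [← ofReal_integral_eq_lintegral_ofReal ((hL2 _).integrable_norm_pow two_ne_zero)
      (Eventually.of_forall fun _ => sq_nonneg _)]
    exact ENNReal.ofReal_le_ofReal (hC _)
  have h2 : Integrable (fun ω => ‖g (Z k ω) (θ k ω)‖ ^ 2) P := by
    refine ⟨(hgm.norm.pow_const 2).aestronglyMeasurable, ?_⟩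
    rw [hasFiniteIntegral_iff_ofReal (Eventually.of_forall fun ω => sq_nonneg _)]
    exact h1.trans_lt ENNReal.ofReal_lt_top
  refine ⟨(memLp_two_iff_integrable_sq_norm hgm.aestronglyMeasurable).2 h2, ?_⟩
  rw [integral_eq_lintegral_of_nonneg_ae (Eventually.of_forall fun ω => sq_nonneg _) h2.1]
  refine ENNReal.toReal_le_of_le_ofReal ?_ h1
  rw [← integral_const_mul]
  exact integral_nonneg fun ω => hVnn _

lemma memLp_iterates (hg : Measurable (fun p : Vec d × Vec m => g p.1 p.2))
    (hF : HolderSmooth F L α) (hC0 : 0 ≤ C) (hL2 : ∀ θ, MemLp (fun z => g z θ) 2 ν)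
    (hC : ∀ θ, ∫ z, ‖g z θ‖ ^ 2 ∂ν ≤ C * excess F θ)
    (hdr : IsDriven P ν ℱ θ Z) (h0 : MemLp (θ 0) 2 P)
    (hrec : ∀ k ω, θ (k + 1) ω = θ k ω - η k • g (Z k ω) (θ k ω)) (k : ℕ) :
    MemLp (θ k) 2 P := by
  induction k with
  | zero => exact h0
  | succ k ih =>
    have h1 := (memLp_oracle_and_integral_le hg hF hC0 hL2 hC hdr ih).1
    rw [funext (hrec k)]
    exact ih.sub (h1.const_smul (η k))

variable [IsProbabilityMeasure ν]

/-- Conditioning the descent inequality, the linear term has a favourable sign by alignment. The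
remainder `L (η k)^(1+α) (1 + C * excess)` becomes multiplicative because the excess is at least 1.
-/
lemma condExp_excess_le (hg : Measurable (fun p : Vec d × Vec m => g p.1 p.2))
    (hF : HolderSmooth F L α) (hC0 : 0 ≤ C) (hL2 : ∀ θ, MemLp (fun z => g z θ) 2 ν)
    (hC : ∀ θ, ∫ z, ‖g z θ‖ ^ 2 ∂ν ≤ C * excess F θ)
    (hgc : Continuous (gradient F))
    (halign : ∀ θ, 0 ≤ inner ℝ (gradient F θ) (∫ z, g z θ ∂ν))
    (hdr : IsDriven P ν ℱ θ Z) (hη : ∀ k, 0 < η k) (hθ : ∀ k, MemLp (θ k) 2 P)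
    (hrec : ∀ k ω, θ (k + 1) ω = θ k ω - η k • g (Z k ω) (θ k ω)) (k : ℕ) :
    P[fun ω => excess F (θ (k + 1) ω) | ℱ k] ≤ᵐ[P]
      fun ω => (1 + L * (1 + C) * η k ^ (1 + α)) * excess F (θ k ω) := by
  have hL := hF.L_pos
  set φ : Vec m × Vec d → ℝ := fun p => excess F p.1
    - η k * inner ℝ (gradient F p.1) (g p.2 p.1)
    + L * η k ^ (1 + α) * (1 + ‖g p.2 p.1‖ ^ 2) with hφ
  have hg' : Measurable (fun p : Vec m × Vec d => g p.2 p.1) := hg.comp measurable_swap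
  have hφm : Measurable φ := by
    have h1 : Measurable (fun p : Vec m × Vec d => gradient F p.1) :=
      hgc.measurable.comp measurable_fst
    have h2 : Measurable (fun p : Vec m × Vec d => excess F p.1) :=
      hF.measurable_excess.comp measurable_fst
    exact (h2.sub ((h1.inner hg').const_mul _)).add
      (((hg'.norm.pow_const 2).const_add 1).const_mul _)
  have hgL := (memLp_oracle_and_integral_le hg hF hC0 hL2 hC hdr (hθ k)).1
  have hg2 : Integrable (fun ω => ‖g (Z k ω) (θ k ω)‖ ^ 2) P :=
    hgL.integrable_norm_pow two_ne_zero
  have hin : Integrable (fun ω => (inner ℝ (gradient F (θ k ω)) (g (Z k ω) (θ k ω)) : ℝ)) P := by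
    obtain ⟨K, hK0, hK⟩ := hF.exists_norm_gradient_le
    have h1 : MemLp (fun ω => gradient F (θ k ω)) 2 P := by
      refine MemLp.mono' (g := fun ω => K * (1 + ‖θ k ω‖))
        (((memLp_const (1 : ℝ)).add (hθ k).norm).const_mul K)
        (hgc.measurable.comp (hdr.measurable k)).aestronglyMeasurable
        (Eventually.of_forall fun ω => hK _)
    refine ((h1.integrable_norm_pow two_ne_zero).add hg2).mono'
      (h1.1.inner hgL.1) (Eventually.of_forall fun ω => ?_)
    refine (norm_inner_le_norm _ _).trans ?_
    simp only [Pi.add_apply]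
    nlinarith [sq_nonneg (‖gradient F (θ k ω)‖ - ‖g (Z k ω) (θ k ω)‖),
      sq_nonneg ‖gradient F (θ k ω)‖, sq_nonneg ‖g (Z k ω) (θ k ω)‖]
  have hφi : Integrable (fun ω => φ (θ k ω, Z k ω)) P :=
    ((hF.integrable_excess (hθ k)).sub (hin.const_mul _)).add
      (((integrable_const 1).add hg2).const_mul _)
  have hle : (fun ω => excess F (θ (k + 1) ω)) ≤ᵐ[P] fun ω => φ (θ k ω, Z k ω) := by
    refine Eventually.of_forall fun ω => ?_
    have h1 := hF.descent (θ k ω) (θ (k + 1) ω)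
    have h2 : θ (k + 1) ω - θ k ω = -(η k • g (Z k ω) (θ k ω)) := by rw [hrec]; abel
    rw [h2, inner_neg_right, inner_smul_right, norm_neg, norm_smul,
      Real.norm_of_nonneg (hη k).le, Real.mul_rpow (hη k).le (norm_nonneg _)] at h1
    have h3 := mul_le_mul_of_nonneg_left (rpow_one_add_le (norm_nonneg (g (Z k ω) (θ k ω)))
      hF.α_pos hF.α_le_one) (mul_nonneg hL.le (Real.rpow_nonneg (hη k).le (1 + α)))
    simp only [hφ, excess]
    linarith
  filter_upwards [condExp_mono (m := ℱ k) (hF.integrable_excess (hθ (k + 1))) hφi hle,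
    hdr.condExp hφm hφi] with ω h1 h2
  refine h1.trans (h2.le.trans ?_)
  set x := θ k ω
  have hi2 : Integrable (fun z => ‖g z x‖ ^ 2) ν := (hL2 x).integrable_norm_pow two_ne_zero
  have hi1 : Integrable (fun z => (inner ℝ (gradient F x) (g z x) : ℝ)) ν :=
    ((hL2 x).integrable one_le_two).const_inner _
  have e1 : ∫ z, φ (x, z) ∂ν = excess F x - η k * inner ℝ (gradient F x) (∫ z, g z x ∂ν)
      + L * η k ^ (1 + α) * (1 + ∫ z, ‖g z x‖ ^ 2 ∂ν) := by
    have j1 : Integrable (fun z => excess F x - η k * (inner ℝ (gradient F x) (g z x) : ℝ)) ν :=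
      (integrable_const _).sub (hi1.const_mul _)
    have j2 : Integrable (fun z => 1 + ‖g z x‖ ^ 2) ν := (integrable_const _).add hi2
    simp only [hφ]
    rw [integral_add j1 (j2.const_mul _), integral_sub (integrable_const _) (hi1.const_mul _),
      integral_const_mul, integral_const_mul, integral_add (integrable_const _) hi2,
      integral_inner ((hL2 x).integrable one_le_two)]
    simp
  rw [e1]
  have h3 := mul_nonneg (hη k).le (halign x)
  have hs : 0 ≤ L * η k ^ (1 + α) := mul_nonneg hL.le (Real.rpow_nonneg (hη k).le _)
  have h4 := mul_le_mul_of_nonneg_left (hC x) hs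
  have h5 := mul_le_mul_of_nonneg_left (hF.one_le_excess x) hs
  linarith

/-- Weighted sums of the noise in bounded directions converge. -/
lemma ae_exists_tendsto_sum_noise (hg : Measurable (fun p : Vec d × Vec m => g p.1 p.2))
    (hL2 : ∀ θ, MemLp (fun z => g z θ) 2 ν)
    (hC : ∀ θ, ∫ z, ‖g z θ‖ ^ 2 ∂ν ≤ C * excess F θ)
    (hdr : IsDriven P ν ℱ θ Z) {h : Vec m → Vec m} (hh : Measurable h) {B : ℝ} (hB : 0 ≤ B)
    (hhB : ∀ x, ‖h x‖ ^ 2 * (C * excess F x) ≤ B) {w : ℕ → ℝ}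
    (hw : Summable (fun k => w k ^ 2)) :
    ∀ᵐ ω ∂P, ∃ x, Tendsto (fun n => ∑ k ∈ Finset.range n,
      w k * inner ℝ (h (θ k ω)) (g (Z k ω) (θ k ω) - ∫ z, g z (θ k ω) ∂ν)) atTop (𝓝 x) := by
  set b : Vec m → Vec m := fun x => ∫ z, g z x ∂ν with hb
  have hbm : Measurable b := measurable_integral_oracle hg
  have hgi : ∀ x, Integrable (fun z => g z x) ν := fun x => (hL2 x).integrable one_le_two
  have hg' : Measurable (fun p : Vec m × Vec d => g p.2 p.1) := hg.comp measurable_swap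
  refine hdr.ae_exists_tendsto_sum
    (ψ := fun p => inner ℝ (h p.1) (g p.2 p.1 - b p.1))
    ((hh.comp measurable_fst).inner (hg'.sub (hbm.comp measurable_fst))) hB (fun x => ?_)
    (fun x => ?_) hw
  · have h1 : Integrable (fun z => g z x - b x) ν := (hgi x).sub (integrable_const _)
    change ∫ z, inner ℝ (h x) (g z x - b x) ∂ν = 0
    rw [integral_inner h1, integral_sub (hgi x) (integrable_const _)]
    simp [hb]
  · have hD : MemLp (fun z => g z x - b x) 2 ν := (hL2 x).sub (memLp_const _)
    have hD2 : Integrable (fun z => ‖g z x - b x‖ ^ 2) ν := hD.integrable_norm_pow two_ne_zero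
    have hvar : ∫ z, ‖g z x - b x‖ ^ 2 ∂ν ≤ C * excess F x := by
      have e1 : ∀ z, ‖g z x - b x‖ ^ 2
          = ‖g z x‖ ^ 2 - 2 * inner ℝ (b x) (g z x) + ‖b x‖ ^ 2 := fun z => by
        rw [norm_sub_sq_real, real_inner_comm]
      have i1 : Integrable (fun z => ‖g z x‖ ^ 2) ν := (hL2 x).integrable_norm_pow two_ne_zero
      have i2 : Integrable (fun z => 2 * (inner ℝ (b x) (g z x) : ℝ)) ν :=
        ((hgi x).const_inner _).const_mul 2
      have i3 : Integrable (fun z => ‖g z x‖ ^ 2 - 2 * (inner ℝ (b x) (g z x) : ℝ)) ν := i1.sub i2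
      simp only [e1]
      rw [integral_add i3 (integrable_const _), integral_sub i1 i2, integral_const_mul,
        integral_inner (hgi x)]
      change _ - 2 * inner ℝ (b x) (b x) + _ ≤ _
      rw [real_inner_self_eq_norm_sq]
      simp only [integral_const, probReal_univ, one_smul]
      have := hC x
      have := sq_nonneg ‖b x‖
      linarith
    calc ∫⁻ z, ENNReal.ofReal ((inner ℝ (h x) (g z x - b x) : ℝ) ^ 2) ∂ν
        ≤ ∫⁻ z, ENNReal.ofReal (‖h x‖ ^ 2 * ‖g z x - b x‖ ^ 2) ∂ν := by
          refine lintegral_mono fun z => ENNReal.ofReal_le_ofReal ?_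
          rw [← mul_pow, ← sq_abs]
          exact pow_le_pow_left₀ (abs_nonneg _) (abs_real_inner_le_norm _ _) 2
      _ = ENNReal.ofReal (‖h x‖ ^ 2 * ∫ z, ‖g z x - b x‖ ^ 2 ∂ν) := by
          rw [← integral_const_mul, ofReal_integral_eq_lintegral_ofReal (hD2.const_mul _)
            (Eventually.of_forall fun z => by positivity)]
      _ ≤ ENNReal.ofReal B := ENNReal.ofReal_le_ofReal
          ((mul_le_mul_of_nonneg_left hvar (sq_nonneg _)).trans (hhB x))

end Oracle

/-- Tonelli: the expectation of the whole series is finite. -/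
lemma ae_summable_mul {Ω : Type*} [MeasurableSpace Ω] {P : Measure Ω} {Y : ℕ → Ω → ℝ} {R : ℝ}
    (hY : ∀ k, Integrable (Y k) P) (hnn : ∀ k ω, 0 ≤ Y k ω) (hR : ∀ k, ∫ ω, Y k ω ∂P ≤ R)
    {w : ℕ → ℝ} (hw0 : ∀ k, 0 ≤ w k) (hw : Summable w) :
    ∀ᵐ ω ∂P, Summable (fun k => w k * Y k ω) := by
  have hm : ∀ k, AEMeasurable (fun ω => ENNReal.ofReal (w k * Y k ω)) P := fun k =>
    ((hY k).1.aemeasurable.const_mul _).ennreal_ofReal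
  have hfin : ∫⁻ ω, ∑' k, ENNReal.ofReal (w k * Y k ω) ∂P ≠ ⊤ := by
    rw [lintegral_tsum hm]
    have h1 : ∀ k, ∫⁻ ω, ENNReal.ofReal (w k * Y k ω) ∂P ≤ ENNReal.ofReal (w k * R) := by
      intro k
      rw [← ofReal_integral_eq_lintegral_ofReal ((hY k).const_mul _)
        (Eventually.of_forall fun ω => mul_nonneg (hw0 k) (hnn k ω)), integral_const_mul]
      exact ENNReal.ofReal_le_ofReal (mul_le_mul_of_nonneg_left (hR k) (hw0 k))
    exact ne_top_of_le_ne_top (hw.mul_right R).tsum_ofReal_ne_top (ENNReal.tsum_le_tsum h1)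
  filter_upwards [ae_lt_top' (AEMeasurable.tsum hm) hfin] with ω hω
  refine (ENNReal.summable_toReal hω.ne).congr fun k => ?_
  exact ENNReal.toReal_ofReal (mul_nonneg (hw0 k) (hnn k ω))

/-! ### Summability of the weights -/

section Weights

variable {η : ℕ → ℝ} {K ρ q α : ℝ}

/-- One of the two factors `η k` is bounded by the rate `t^(-ρ)`; what remains is `η t^(-(ρ - 2q))`,
and Abel–Dini needs exactly `ρ - 2q > 1`. -/
lemma summable_sq_weights (hη : ∀ k, 0 < η k)
    (hle : ∀ᶠ k in atTop, η k ≤ K * (∑ j ∈ Finset.range (k + 1), η j) ^ (-ρ))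
    (hq : 2 * q < ρ - 1) :
    Summable (fun k => ((∑ j ∈ Finset.range (k + 1), η j) ^ q * η k) ^ 2) := by
  refine Summable.of_norm_bounded_eventually_nat
    ((summable_mul_sum_rpow_neg hη (by linarith : 1 < ρ - 2 * q)).mul_left K) ?_
  filter_upwards [hle] with k hk
  have ht := sum_range_succ_pos hη k
  set t := ∑ j ∈ Finset.range (k + 1), η j
  rw [Real.norm_of_nonneg (sq_nonneg _)]
  have h1 : (t ^ q * η k) ^ 2 = η k * t ^ (2 * q) * η k := by
    rw [mul_pow, ← Real.rpow_natCast (t ^ q) 2, ← Real.rpow_mul ht.le, Nat.cast_ofNat, mul_comm q]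
    ring
  have h2 : K * (η k * t ^ (-(ρ - 2 * q))) = η k * t ^ (2 * q) * (K * t ^ (-ρ)) := by
    rw [show -(ρ - 2 * q) = 2 * q + -ρ by ring, Real.rpow_add ht]; ring
  rw [h1, h2]
  exact mul_le_mul_of_nonneg_left hk (mul_nonneg (hη k).le (Real.rpow_nonneg ht.le _))

/-- As in the square case, with the factor `(η k)^α` bounded by a multiple of `t^(-ρα)`; the
absolute value of `K` makes its power usable whatever its sign. -/
lemma summable_rpow_weights (hη : ∀ k, 0 < η k) (hα : 0 < α)
    (hle : ∀ᶠ k in atTop, η k ≤ K * (∑ j ∈ Finset.range (k + 1), η j) ^ (-ρ))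
    (hq : q < ρ * α - 1) :
    Summable (fun k => (∑ j ∈ Finset.range (k + 1), η j) ^ q * η k ^ (1 + α)) := by
  refine Summable.of_norm_bounded_eventually_nat
    ((summable_mul_sum_rpow_neg hη (by linarith : 1 < ρ * α - q)).mul_left (|K| ^ α)) ?_
  filter_upwards [hle] with k hk
  have ht := sum_range_succ_pos hη k
  set t := ∑ j ∈ Finset.range (k + 1), η j
  rw [Real.norm_of_nonneg (mul_nonneg (Real.rpow_nonneg ht.le _)
    (Real.rpow_nonneg (hη k).le _))]
  have h0 : η k ≤ |K| * t ^ (-ρ) :=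
    hk.trans (mul_le_mul_of_nonneg_right (le_abs_self K) (Real.rpow_nonneg ht.le _))
  have h1 := Real.rpow_le_rpow (hη k).le h0 hα.le
  rw [Real.mul_rpow (abs_nonneg K) (Real.rpow_nonneg ht.le _), ← Real.rpow_mul ht.le] at h1
  have h2 : |K| ^ α * (η k * t ^ (-(ρ * α - q))) = t ^ q * η k * (|K| ^ α * t ^ (-ρ * α)) := by
    rw [show -(ρ * α - q) = q + -ρ * α by ring, Real.rpow_add ht]; ring
  rw [h2, Real.rpow_add (hη k), Real.rpow_one, ← mul_assoc]
  exact mul_le_mul_of_nonneg_left h1 (mul_nonneg (Real.rpow_nonneg ht.le _) (hη k).le)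

lemma summable_sq_steps (hη : ∀ k, 0 < η k)
    (hle : ∀ᶠ k in atTop, η k ≤ K * (∑ j ∈ Finset.range (k + 1), η j) ^ (-ρ)) (hρ : 1 < ρ) :
    Summable (fun k => η k ^ 2) := by
  refine (summable_sq_weights (q := 0) hη hle (by linarith)).congr fun k => ?_
  rw [Real.rpow_zero, one_mul]

end Weights

/-! ### The history of the scheme -/

section History

variable {Ω : Type*} [mΩ : MeasurableSpace Ω] {P : Measure Ω} {d m : ℕ}
  {X : Ω → Vec d} {ξ : ℕ → Ω → Vec d} {θ₀ : Ω → Vec m} {g : Vec d → Vec m → Vec m} {γ : ℕ → ℝ}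

/-- The initial point together with the first `n` innovations. -/
def history (θ₀ : Ω → Vec m) (ξ : ℕ → Ω → Vec d) (n : ℕ) (ω : Ω) :
    Vec m × (Finset.range n → Vec d) :=
  (θ₀ ω, fun i => ξ (i + 1) ω)

lemma Randomness.measurable_history (h : Randomness P X ξ θ₀) (n : ℕ) :
    Measurable (history θ₀ ξ n) :=
  h.measurable_init.prodMk (measurable_pi_lambda _ fun i =>
    h.measurable_innovation _ (Nat.le_add_left 1 i))

/-- The filtration generated by the initial point and the innovations. -/
def Randomness.filtration (h : Randomness P X ξ θ₀) : Filtration ℕ mΩ where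
  seq n := MeasurableSpace.comap (history θ₀ ξ n) inferInstance
  mono' i j hij := by
    let r : Vec m × (Finset.range j → Vec d) → Vec m × (Finset.range i → Vec d) := fun p =>
      (p.1, fun k => p.2 ⟨k, Finset.range_subset_range.2 hij k.2⟩)
    have hr : Measurable r := measurable_fst.prodMk (measurable_pi_lambda _ fun k =>
      (measurable_pi_apply _).comp measurable_snd)
    have e : history θ₀ ξ i = r ∘ history θ₀ ξ j := rfl
    change MeasurableSpace.comap (history θ₀ ξ i) _ ≤ MeasurableSpace.comap (history θ₀ ξ j) _
    rw [e, ← MeasurableSpace.comap_comp]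
    exact MeasurableSpace.comap_mono hr.comap_le
  le' n := (h.measurable_history n).comap_le

/-- Mutual independence separates the next innovation from the earlier ones; independence of `θ₀`
from the whole sequence then allows the initial point to be adjoined. -/
lemma Randomness.indepFun_history [IsProbabilityMeasure P] (h : Randomness P X ξ θ₀) (n : ℕ) :
    IndepFun (history θ₀ ξ n) (ξ (n + 1)) P := by
  have hm : ∀ k, Measurable (ξ (k + 1)) := fun k => h.measurable_innovation _ (by omega)
  refine indepFun_prodMk_of_indepFun h.measurable_init
    (measurable_pi_lambda _ fun i => hm i) (hm n) ?_ ?_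
  · exact h.indep_init.comp (φ := id)
      (ψ := fun (x : ℕ → Vec d) => ((fun i : Finset.range n => x i), x n)) measurable_id
      ((measurable_pi_lambda _ fun i => measurable_pi_apply _).prodMk (measurable_pi_apply n))
  · have h1 := h.iIndep.indepFun_finset (Finset.range n) {n} (by simp) hm
    exact h1.comp (φ := id) (ψ := fun x : ({n} : Finset ℕ) → Vec d => x ⟨n, by simp⟩)
      measurable_id (measurable_pi_apply _)

lemma Randomness.isDriven [IsProbabilityMeasure P] (h : Randomness P X ξ θ₀)
    (hg : Measurable (fun p : Vec d × Vec m => g p.1 p.2)) :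
    IsDriven P (P.map X) h.filtration (iterate g γ ξ θ₀) (fun k => ξ (k + 1)) := by
  have hist : ∀ k, Measurable[h.filtration k] (history θ₀ ξ k) := fun k =>
    comap_measurable _
  have hZ : ∀ k, Measurable[h.filtration (k + 1)] (ξ (k + 1)) := fun k =>
    ((measurable_pi_apply (⟨k, by simp⟩ : Finset.range (k + 1))).comp measurable_snd).comp
      (hist (k + 1))
  refine ⟨fun k => ?_, hZ, fun k => (h.indepFun_history k).symm,
    fun k => (h.identDistrib (k + 1) (by omega)).map_eq⟩
  induction k with
  | zero => exact measurable_fst.comp (hist 0)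
  | succ k ih =>
    have ih' : Measurable[h.filtration (k + 1)] (iterate g γ ξ θ₀ k) :=
      ih.mono (h.filtration.mono k.le_succ) le_rfl
    exact ih'.sub ((hg.comp ((hZ k).prodMk ih')).const_smul (γ (k + 1)))

end History

/-! ### Convergence -/

section Convergence

variable {d m : ℕ} {F : Vec m → ℝ} {L α C κ c K ρ : ℝ} {g : Vec d → Vec m → Vec m}
  {ν : Measure (Vec d)} [IsProbabilityMeasure ν]
  {Ω : Type*} [mΩ : MeasurableSpace Ω] {P : Measure Ω} [IsProbabilityMeasure P]
  {ℱ : Filtration ℕ mΩ} {θ : ℕ → Ω → Vec m} {Z : ℕ → Ω → Vec d} {η : ℕ → ℝ}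

/-- Localization: cutting the direction off outside `excess F ≤ j` gives uniformly bounded
variances, hence convergence almost surely for all integers `j` at once. On a path with bounded
excess the cutoff is inactive for large `j`. -/
lemma ae_exists_tendsto_sum_noise_of_bdd (hg : Measurable (fun p : Vec d × Vec m => g p.1 p.2))
    (hF : HolderSmooth F L α) (hC0 : 0 ≤ C) (hL2 : ∀ θ, MemLp (fun z => g z θ) 2 ν)
    (hC : ∀ θ, ∫ z, ‖g z θ‖ ^ 2 ∂ν ≤ C * excess F θ) (hdr : IsDriven P ν ℱ θ Z)
    (hbdd : ∀ᵐ ω ∂P, BddAbove (Set.range fun k => excess F (θ k ω))) {h : Vec m → Vec m}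
    (hh : Measurable h) (hhB : ∀ K, ∃ B, ∀ x, excess F x ≤ K → ‖h x‖ ≤ B) {w : ℕ → ℝ}
    (hw : Summable (fun k => w k ^ 2)) :
    ∀ᵐ ω ∂P, ∃ x, Tendsto (fun n => ∑ k ∈ Finset.range n,
      w k * inner ℝ (h (θ k ω)) (g (Z k ω) (θ k ω) - ∫ z, g z (θ k ω) ∂ν)) atTop (𝓝 x) := by
  have key : ∀ j : ℕ, ∀ᵐ ω ∂P, ∃ x, Tendsto (fun n => ∑ k ∈ Finset.range n,
      w k * inner ℝ ({x | excess F x ≤ j}.indicator h (θ k ω))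
        (g (Z k ω) (θ k ω) - ∫ z, g z (θ k ω) ∂ν)) atTop (𝓝 x) := by
    intro j
    obtain ⟨B, hB⟩ := hhB j
    refine ae_exists_tendsto_sum_noise (B := B ^ 2 * (C * j)) hg hL2 hC hdr
      (hh.indicator (measurableSet_le hF.measurable_excess measurable_const)) (by positivity)
      (fun x => ?_) hw
    by_cases hx : excess F x ≤ j
    · rw [Set.indicator_of_mem (show x ∈ {x | excess F x ≤ j} from hx)]
      exact mul_le_mul (pow_le_pow_left₀ (norm_nonneg _) (hB x hx) 2)
        (mul_le_mul_of_nonneg_left hx hC0)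
        (mul_nonneg hC0 (zero_le_one.trans (hF.one_le_excess x))) (sq_nonneg _)
    · rw [Set.indicator_of_notMem (show x ∉ {x | excess F x ≤ j} from hx)]
      simp only [norm_zero, ne_eq, OfNat.ofNat_ne_zero, not_false_eq_true, zero_pow, zero_mul]
      positivity
  filter_upwards [ae_all_iff.2 key, hbdd] with ω h1 ⟨M, hM⟩
  obtain ⟨j, hj⟩ := exists_nat_ge M
  obtain ⟨x, hx⟩ := h1 j
  refine ⟨x, hx.congr fun n => Finset.sum_congr rfl fun k _ => ?_⟩
  rw [Set.indicator_of_mem (show θ k ω ∈ {x | excess F x ≤ j} from (hM ⟨k, rfl⟩).trans hj)]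

/-- Coordinatewise, with the constant directions of the standard basis. -/
lemma ae_exists_tendsto_sum_smul_noise (hg : Measurable (fun p : Vec d × Vec m => g p.1 p.2))
    (hF : HolderSmooth F L α) (hC0 : 0 ≤ C) (hL2 : ∀ θ, MemLp (fun z => g z θ) 2 ν)
    (hC : ∀ θ, ∫ z, ‖g z θ‖ ^ 2 ∂ν ≤ C * excess F θ) (hdr : IsDriven P ν ℱ θ Z)
    (hbdd : ∀ᵐ ω ∂P, BddAbove (Set.range fun k => excess F (θ k ω))) {w : ℕ → ℝ}
    (hw : Summable (fun k => w k ^ 2)) :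
    ∀ᵐ ω ∂P, ∃ x, Tendsto (fun n => ∑ k ∈ Finset.range n,
      w k • (g (Z k ω) (θ k ω) - ∫ z, g z (θ k ω) ∂ν)) atTop (𝓝 x) := by
  have key : ∀ i : Fin m, ∀ᵐ ω ∂P, ∃ x, Tendsto (fun n => ∑ k ∈ Finset.range n,
      w k * inner ℝ (EuclideanSpace.single i (1 : ℝ))
        (g (Z k ω) (θ k ω) - ∫ z, g z (θ k ω) ∂ν)) atTop (𝓝 x) := fun i =>
    ae_exists_tendsto_sum_noise_of_bdd hg hF hC0 hL2 hC hdr hbdd measurable_const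
      (fun _ => ⟨1, fun x _ => by simp⟩) hw
  filter_upwards [ae_all_iff.2 key] with ω h1
  choose x hx using h1
  refine ⟨WithLp.toLp 2 x, ?_⟩
  have h2 : Tendsto (fun n => WithLp.ofLp (∑ k ∈ Finset.range n,
      w k • (g (Z k ω) (θ k ω) - ∫ z, g z (θ k ω) ∂ν))) atTop (𝓝 x) := by
    refine tendsto_pi_nhds.2 fun i => (hx i).congr fun n => ?_
    simp [EuclideanSpace.inner_single_left]
  exact ((PiLp.continuous_toLp 2 _).tendsto x).comp h2

/-- Almost sure convergence of stochastic gradient descent under Łojasiewicz inequalities. -/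
theorem ae_exists_tendsto (hg : Measurable (fun p : Vec d × Vec m => g p.1 p.2))
    (hF : HolderSmooth F L α) (hC0 : 0 ≤ C) (hL2 : ∀ θ, MemLp (fun z => g z θ) 2 ν)
    (hC : ∀ θ, ∫ z, ‖g z θ‖ ^ 2 ∂ν ≤ C * excess F θ)
    (hκ : 0 < κ) (hc : 0 < c)
    (halign : ∀ θ, κ * ‖gradient F θ‖ ^ 2 ≤ inner ℝ (gradient F θ) (∫ z, g z θ ∂ν))
    (hdom : ∀ θ, ‖∫ z, g z θ ∂ν‖ ≤ c * ‖gradient F θ‖)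
    (hcoer : Coercive F) (hloj : IsLojasiewicz F) (hdr : IsDriven P ν ℱ θ Z)
    (hη : ∀ k, 0 < η k) (hηtop : Tendsto (fun n => ∑ k ∈ Finset.range n, η k) atTop atTop)
    (hle : ∀ᶠ k in atTop, η k ≤ K * (∑ j ∈ Finset.range (k + 1), η j) ^ (-ρ))
    (hρ : 3 < ρ) (hρα : 2 < ρ * α) {R : ℝ} (hθ : ∀ k, MemLp (θ k) 2 P)
    (hR : ∀ k, ∫ ω, excess F (θ k ω) ∂P ≤ R)
    (hbdd : ∀ᵐ ω ∂P, BddAbove (Set.range fun k => excess F (θ k ω)))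
    (hrec : ∀ k ω, θ (k + 1) ω = θ k ω - η k • g (Z k ω) (θ k ω)) :
    ∀ᵐ ω ∂P, ∃ θs, Tendsto (fun n => θ n ω) atTop (𝓝 θs) ∧ gradient F θs = 0 := by
  have hL := hF.L_pos
  have hgc := gradient_continuous hloj.contDiff
  -- The two upper bounds come from the martingale part and from the `1 + α` part of the error; they
  -- leave room above 1 precisely because `ρ > 3` and `ρ α > 2`.
  obtain ⟨q, hq1, hq2⟩ : ∃ q, 1 < q ∧ q < min ((ρ - 1) / 2) (ρ * α - 1) :=
    exists_between (lt_min (by linarith) (by linarith))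
  have hqa : 2 * q < ρ - 1 := by linarith [hq2.trans_le (min_le_left _ _)]
  have hqb : q < ρ * α - 1 := hq2.trans_le (min_le_right _ _)
  have tpos := sum_range_succ_pos hη
  set t : ℕ → ℝ := fun k => ∑ j ∈ Finset.range (k + 1), η j with ht
  have tmono : Monotone t := monotone_nat_of_le_succ fun n => by
    have : t (n + 1) = t n + η (n + 1) := Finset.sum_range_succ _ _
    linarith [hη (n + 1)]
  have ttop : Tendsto t atTop atTop := hηtop.comp (tendsto_add_atTop_nat 1)
  have n1 := ae_exists_tendsto_sum_noise_of_bdd hg hF hC0 hL2 hC hdr hbdd hgc.measurable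
    (fun K => by
      obtain ⟨R, hR0, hR⟩ := hcoer.exists_norm_le K
      obtain ⟨B, hB0, hB⟩ := hF.exists_norm_gradient_le
      refine ⟨B * (1 + R), fun x hx => (hB x).trans ?_⟩
      exact mul_le_mul_of_nonneg_left (by linarith [hR x hx]) hB0)
    (summable_sq_weights hη hle hqa)
  have n2 := ae_exists_tendsto_sum_smul_noise hg hF hC0 hL2 hC hdr hbdd
    (summable_sq_steps hη hle (by linarith))
  have hG := fun k => memLp_oracle_and_integral_le hg hF hC0 hL2 hC hdr (hθ k)
  have hG2 : ∀ k, Integrable (fun ω => ‖g (Z k ω) (θ k ω)‖ ^ 2) P := fun k =>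
    (hG k).1.integrable_norm_pow two_ne_zero
  have n3 := ae_summable_mul (P := P) (Y := fun k ω => 1 + ‖g (Z k ω) (θ k ω)‖ ^ 2)
    (R := 1 + C * R) (fun k => (integrable_const _).add (hG2 k)) (fun k ω => by positivity)
    (fun k => by
      rw [integral_add (integrable_const _) (hG2 k)]
      have h1 := (hG k).2.trans (mul_le_mul_of_nonneg_left (hR k) hC0)
      simpa using h1)
    (fun k => mul_nonneg (Real.rpow_nonneg (tpos k).le q) (Real.rpow_nonneg (hη k).le (1 + α)))
    (summable_rpow_weights hη hF.α_pos hle hqb)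
  filter_upwards [hbdd, n1, n2, n3] with ω ⟨M, hM⟩ ⟨x, hx⟩ h2 h3
  set b : Vec m → Vec m := fun y => ∫ z, g z y ∂ν with hb
  set D : ℕ → Vec m := fun k => g (Z k ω) (θ k ω) - b (θ k ω) with hD
  -- The error in the descent inequality. Weighted by `t ^ q`, its two parts are summed by `n3` and
  -- `n1`, while `n2` handles the noise in the recursion itself.
  set a : ℕ → ℝ := fun k => L * η k ^ (1 + α) * (1 + ‖g (Z k ω) (θ k ω)‖ ^ 2)
    - η k * inner ℝ (gradient F (θ k ω)) (D k) with ha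
  obtain ⟨y, hy⟩ : ∃ y, Tendsto (fun n => ∑ k ∈ Finset.range n, t k ^ q * a k) atTop (𝓝 y) := by
    refine ⟨_, ((h3.hasSum.tendsto_sum_nat.const_mul L).sub hx).congr fun n => ?_⟩
    rw [Finset.mul_sum, ← Finset.sum_sub_distrib]
    refine Finset.sum_congr rfl fun k _ => ?_
    simp only [ha, hD, hb, ht]
    ring
  obtain ⟨B, hB⟩ := hy.abs.bddAbove_range
  obtain ⟨l, -, hl⟩ := exists_tendsto_sum_of_weighted_bdd (a := a) (u := fun k => t k ^ q)
    (B := B) (fun k => Real.rpow_pos_of_pos (tpos k) q)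
    (fun i j hij => Real.rpow_le_rpow (tpos i).le (tmono hij) (by linarith))
    ((tendsto_rpow_atTop (by linarith)).comp ttop) (fun n => hB ⟨n, rfl⟩)
  refine exists_tendsto_of_perturbed_descent hloj hF.bddBelow (b := fun k => b (θ k ω)) (D := D)
    (η := η) (a := a) (q := q) (R := 2 * B) (l := l) hκ hc hq1 hη hηtop (fun k => ?_)
    (fun k => hdom _) h2 (fun k => ?_) (fun n => ?_) ?_
  · rw [hrec]; simp [hD]
  · have h1 := hF.descent (θ k ω) (θ (k + 1) ω)
    have e1 : θ (k + 1) ω - θ k ω = -(η k • (D k + b (θ k ω))) := by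
      rw [hrec]; simp [hD]
    have e2 : D k + b (θ k ω) = g (Z k ω) (θ k ω) := by simp [hD]
    rw [e1, inner_neg_right, inner_smul_right, inner_add_right, norm_neg, e2, norm_smul,
      Real.norm_of_nonneg (hη k).le, Real.mul_rpow (hη k).le (norm_nonneg _)] at h1
    have h4 := mul_le_mul_of_nonneg_left (rpow_one_add_le (norm_nonneg (g (Z k ω) (θ k ω)))
      hF.α_pos hF.α_le_one) (mul_nonneg hL.le (Real.rpow_nonneg (hη k).le (1 + α)))
    have h5 := mul_le_mul_of_nonneg_left (halign (θ k ω)) (hη k).le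
    simp only [ha]
    linarith
  · rw [Real.rpow_neg (tpos n).le]
    exact hl n
  · obtain ⟨r, -, hr⟩ := hcoer.exists_norm_le M
    refine isBounded_iff_forall_norm_le.2 ⟨r, ?_⟩
    rintro _ ⟨k, rfl⟩
    exact hr _ (hM ⟨k, rfl⟩)

end Convergence

/-! ### The main theorem -/

lemma sum_Icc_one_eq_sum_range (γ : ℕ → ℝ) (n : ℕ) :
    ∑ k ∈ Finset.Icc 1 n, γ k = ∑ k ∈ Finset.range n, γ (k + 1) := by
  induction n with
  | zero => simp
  | succ n ih => rw [Finset.sum_Icc_succ_top (by omega), ih, Finset.sum_range_succ]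

end SGD

theorem mainTheorem7 {Ω : Type*} [MeasurableSpace Ω] (P : Measure Ω) [IsProbabilityMeasure P]
    {d m : ℕ} (f : Vec d → Vec m → ℝ) (g : Vec d → Vec m → Vec m)
    (X : Ω → Vec d) (ξ : ℕ → Ω → Vec d) (θ₀ : Ω → Vec m) (γ : ℕ → ℝ)
    (L α C κ c γs ρ s : ℝ)
    (hf : ∀ θ, Integrable (fun ω => f (X ω) θ) P)
    (hg : Measurable (fun p : Vec d × Vec m => g p.1 p.2))
    (hrand : SGD.Randomness P X ξ θ₀)
    (hsmooth : SGD.HolderSmooth (SGD.objective P f X) L α)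
    (horacle : SGD.OracleConditions P (SGD.objective P f X) g X C κ c)
    (hsteps : SGD.StepSizes γ α)
    (hcoercive : SGD.Coercive (SGD.objective P f X))
    (hloj : SGD.IsLojasiewicz (SGD.objective P f X))
    (hasymp : SGD.StepAsymptotics γ α γs ρ)
    (hpoly : SGD.PolynomialSteps γ s)
    (hρ : max 3 (2 / α) < ρ)
    (hs : s ∈ Set.Icc (ρ / (1 + ρ)) 1)
    (hκ : s = 1 → max (1 / 2) α < κ * γs) :
    ∃ (Fs : Ω → ℝ) (θs : Ω → Vec m),
      Measurable Fs ∧ Integrable Fs P ∧ Measurable θs ∧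
      (∀ᵐ ω ∂P, Tendsto (fun n => SGD.objective P f X (SGD.iterate g γ ξ θ₀ n ω))
        atTop (𝓝 (Fs ω))) ∧
      (∀ᵐ ω ∂P, Tendsto (fun n => SGD.iterate g γ ξ θ₀ n ω) atTop (𝓝 (θs ω))) ∧
      (∀ᵐ ω ∂P, gradient (SGD.objective P f X) (θs ω) = 0) ∧
      (∀ᵐ ω ∂P, SGD.objective P f X (θs ω) = Fs ω) := by
  set F := SGD.objective P f X with hFdef
  set ν := P.map X with hν
  have hX := hrand.measurable_X.aemeasurable (μ := P)
  have hpν : IsProbabilityMeasure ν := Measure.isProbabilityMeasure_map hX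
  have hgθ : ∀ θ, Measurable (fun z => g z θ) := fun θ => hg.comp measurable_prodMk_right
  have hmean : ∀ θ, ∫ z, g z θ ∂ν = SGD.meanField P g X θ := fun θ =>
    integral_map hX (hgθ θ).aestronglyMeasurable
  have hL2 : ∀ θ, MemLp (fun z => g z θ) 2 ν := fun θ =>
    (memLp_map_measure_iff (hgθ θ).aestronglyMeasurable hX).2 (horacle.memLp θ)
  have hC : ∀ θ, ∫ z, ‖g z θ‖ ^ 2 ∂ν ≤ C * SGD.excess F θ := fun θ => by
    rw [hν, integral_map hX ((hgθ θ).norm.pow_const 2).aestronglyMeasurable]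
    exact horacle.second_moment θ
  have halign : ∀ θ, κ * ‖gradient F θ‖ ^ 2 ≤ inner ℝ (gradient F θ) (∫ z, g z θ ∂ν) :=
    fun θ => by
      rw [hmean, real_inner_comm]
      exact horacle.alignment θ
  have hdom : ∀ θ, ‖∫ z, g z θ ∂ν‖ ≤ c * ‖gradient F θ‖ := fun θ => by
    rw [hmean]
    exact horacle.domination θ
  have hκ0 := horacle.κ_pos
  -- The step from time `k` to `k + 1` uses `γ (k + 1)`, so the shift makes the step sizes start at
  -- index 0.
  set η : ℕ → ℝ := fun k => γ (k + 1) with hηdef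
  have hη : ∀ k, 0 < η k := fun k => hsteps.pos _ (by omega)
  set θ := SGD.iterate g γ ξ θ₀ with hθdef
  have hdr := hrand.isDriven (γ := γ) hg
  have hrec : ∀ k ω, θ (k + 1) ω = θ k ω - η k • g (ξ (k + 1) ω) (θ k ω) := fun _ _ => rfl
  have hgc := SGD.gradient_continuous hloj.contDiff
  have hθL := SGD.memLp_iterates hg hsmooth horacle.C_pos.le hL2 hC hdr hrand.memLp_init hrec
  have hpnn : ∀ k, 0 ≤ L * (1 + C) * η k ^ (1 + α) := fun k => by
    have := hsmooth.L_pos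
    have := horacle.C_pos
    have := hη k
    positivity
  obtain ⟨hbdd, R, hR⟩ := SGD.bdd_of_almost_supermartingale
    (V := fun k ω => SGD.excess F (θ k ω)) (ℱ := hrand.filtration)
    (fun k => hsmooth.measurable_excess.comp (hdr.adapted k))
    (fun k => hsmooth.integrable_excess (hθL k))
    (fun k ω => zero_le_one.trans (hsmooth.one_le_excess _)) hpnn
    (hsteps.summable_rpow.mul_left _)
    (SGD.condExp_excess_le hg hsmooth horacle.C_pos.le hL2 hC hgc
      (fun x => (by positivity : (0 : ℝ) ≤ κ * ‖gradient F x‖ ^ 2).trans (halign x)) hdr hη hθL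
      hrec)
  have hηtop : Tendsto (fun n => ∑ k ∈ Finset.range n, η k) atTop atTop :=
    hsteps.sum_eq_top.congr fun n => SGD.sum_Icc_one_eq_sum_range γ n
  obtain ⟨K, hK⟩ := hasymp.isBigO.bound
  have hle : ∀ᶠ k in atTop, η k ≤ K * (∑ j ∈ Finset.range (k + 1), η j) ^ (-ρ) := by
    filter_upwards [(tendsto_add_atTop_nat 1).eventually hK] with k hk
    rw [SGD.sum_Icc_one_eq_sum_range, Real.norm_of_nonneg (hη k).le, Real.norm_of_nonneg
      (Real.rpow_nonneg (SGD.sum_range_succ_pos hη k).le _)] at hk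
    exact hk
  have hρ3 : 3 < ρ := (le_max_left _ _).trans_lt hρ
  have hρα : 2 < ρ * α := (div_lt_iff₀ hsmooth.α_pos).1 ((le_max_right _ _).trans_lt hρ)
  have hconv := SGD.ae_exists_tendsto hg hsmooth horacle.C_pos.le hL2 hC hκ0
    (hκ0.trans_le horacle.κ_le_c) halign hdom hcoercive hloj hdr hη hηtop hle hρ3 hρα hθL hR hbdd
    hrec
  obtain ⟨θs, hθsm, hθs⟩ := measurable_limit_of_tendsto_metrizable_ae
    (fun n => (hdr.measurable n).aemeasurable) (hconv.mono fun ω ⟨x, hx, _⟩ => ⟨x, hx⟩)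
  have hFc : Continuous F := hsmooth.differentiable.continuous
  -- Fatou: the uniform bound `R` on the mean excess passes to the almost sure limit.
  have hint : Integrable (fun ω => SGD.excess F (θs ω)) P := by
    rw [← memLp_one_iff_integrable]
    refine ⟨(hsmooth.measurable_excess.comp hθsm).aestronglyMeasurable,
      (Lp.eLpNorm_le_of_ae_tendsto (f := fun n ω => SGD.excess F (θ n ω)) (u := atTop)
        (C := ENNReal.ofReal R) (Eventually.of_forall fun n => ?_)
        (fun n => (hsmooth.integrable_excess (hθL n)).1) ?_).trans_lt ENNReal.ofReal_lt_top⟩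
    · rw [eLpNorm_one_eq_lintegral_enorm,
        ← ofReal_integral_norm_eq_lintegral_enorm (hsmooth.integrable_excess (hθL n))]
      refine ENNReal.ofReal_le_ofReal (le_trans (le_of_eq ?_) (hR n))
      exact integral_congr_ae (Eventually.of_forall fun ω =>
        Real.norm_of_nonneg (zero_le_one.trans (hsmooth.one_le_excess _)))
    · filter_upwards [hθs] with ω hω
      exact (((hFc.tendsto _).comp hω).sub_const _).add_const _
  refine ⟨fun ω => F (θs ω), θs, hFc.measurable.comp hθsm, ?_, hθsm, ?_, hθs, ?_,
    Eventually.of_forall fun _ => rfl⟩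
  · refine (hint.add (integrable_const ((⨅ ϑ, F ϑ) - 1))).congr (Eventually.of_forall fun ω => ?_)
    simp only [SGD.excess, Pi.add_apply]
    ring
  · filter_upwards [hθs] with ω hω using (hFc.tendsto _).comp hω
  · filter_upwards [hθs, hconv] with ω h1 ⟨x, hx, hx0⟩
    rw [tendsto_nhds_unique h1 hx]
    exact hx0
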